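/- Let $\mathbb{D}=\{z\in\mathbb{C}:|z|<1\}$. Let $\mathcal{A}$ be the class of analytic functions $G$ in $\mathbb{D}$ with $G(0)=0$, $G'(0)=1$; let $\mathcal{S}$ be the class of univalent (one-to-one) functions in $\mathcal{A}$; let $\mathcal{S}^*$ (resp. $\mathcal{K}$) be the class of $G\in\mathcal{S}$ for which $G(\mathbb{D})$ is starlike with respect to the origin (resp. convex); let $\mathcal{R}$ be the class of $G\in\mathcal{A}$ with $\operatorname{Re}G'(z)>0$ in $\mathbb{D}$, and let $\mathcal{R}_{1/2}$ be the class of $G\in\mathcal{A}$ with $\operatorname{Re}G'(z)>1/2$ in $\mathbb{D}$. Let $\mathcal{H}$ be the class of complex-valued harmonic functions $f$ in $\mathbb{D}$ with $f(0)=0$, $f_z(0)=1$, $f_{\bar z}(0)=0$; each is written $f=h+\overline{g}$ with $h,g$ analytic in $\mathbb{D}$ and $h(0)=g(0)=0$. For $G\in\mathcal{A}$ put $$\mathcal{F}_H^0(G)=\left\{f=h+\overline{g}\in\mathcal{H}:\ \left|\frac{h'(z)}{G'(z)}-1\right|<1-\left|\frac{g'(z)}{G'(z)}\right|\ \text{ for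 all } z\in\mathbb{D}\right\}.$$ A function $f$ is called convex in $|z|<\rho$ if it is one-to-one there and maps this disk onto a convex set. For a class $\mathcal{G}\subset\mathcal{A}$, let $r_C(\mathcal{G})$ be the radius of convexity of the family $\bigcup_{G\in\mathcal{G}}\mathcal{F}_H^0(G)$, that is, the largest $r\in(0,1]$ such that for all $G\in\mathcal{G}$ every $f\in\mathcal{F}_H^0(G)$ is convex in $|z|<\rho$ for every $0<\rho\le r$. **Theorem.** (a) $r_C(\mathcal{S})=1/5$; (b) $r_C(\mathcal{S}^*)=1/5$; (c) $r_C(\mathcal{K})=1/3$; (d) $r_C(\mathcal{R})=(\sqrt{17}-3)/4$; (e) $r_C(\mathcal{R}_{1/2})$ is the smallest positive root of $r^4+2r^3+13r^2+4r-4=0$. Moreover, all these results are sharp: in each case, with $\mathcal{G}$ the class concerned, there are a $G\in\mathcal{G}$ and an $f\in\mathcal{F}_H^0(G)$ such that $f$ is not convex in $|z|<\rho$ for any $\rho$ with $r_C(\mathcal{G})<\rho\le 1$. -/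

import Mathlib

namespace HarmonicConvexity

/-- The open unit disk. -/
def unitDisk : Set ℂ := Metric.ball 0 1

/-- The class `𝒜` of analytic functions in the unit disk with `G 0 = 0` and `G' 0 = 1`. Functions
are total functions `ℂ → ℂ`; only their values in the unit disk matter. -/
def classA : Set (ℂ → ℂ) :=
  {G | DifferentiableOn ℂ G unitDisk ∧ G 0 = 0 ∧ deriv G 0 = 1}

/-- The class `𝒮` of normalized univalent analytic functions. -/
def classS : Set (ℂ → ℂ) := {G | G ∈ classA ∧ Set.InjOn G unitDisk}

/-- The class `𝒮*`: members of `𝒮` whose image is starlike with respect to the origin. -/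
def classSStar : Set (ℂ → ℂ) := {G | G ∈ classS ∧ StarConvex ℝ 0 (G '' unitDisk)}

/-- The class `𝒦`: members of `𝒮` whose image is convex. -/
def classK : Set (ℂ → ℂ) := {G | G ∈ classS ∧ Convex ℝ (G '' unitDisk)}

/-- The class `ℛ`: members of `𝒜` whose derivative has positive real part. -/
def classR : Set (ℂ → ℂ) := {G | G ∈ classA ∧ ∀ z ∈ unitDisk, 0 < (deriv G z).re}

/-- Members of `𝒜` whose derivative has real part greater than `1/2`. -/
def classRHalf : Set (ℂ → ℂ) := {G | G ∈ classA ∧ ∀ z ∈ unitDisk, 1 / 2 < (deriv G z).re}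

/-- The class `ℋ` of complex-valued harmonic functions in the unit disk with `f 0 = 0`,
`f_z 0 = 1` and `f_z̄ 0 = 0`. As `df = f_z dz + f_z̄ dz̄`, the last two conditions say that
the real differential of `f` at `0` is the identity. -/
def classH : Set (ℂ → ℂ) :=
  {f | InnerProductSpace.HarmonicOnNhd f unitDisk ∧ f 0 = 0 ∧
    fderiv ℝ f 0 = ContinuousLinearMap.id ℝ ℂ}

/-- The representation `f = h + conj g` in the unit disk, with `h`, `g` analytic there and
vanishing at the origin. -/
def IsCanonicalRep (f h g : ℂ → ℂ) : Prop :=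
  DifferentiableOn ℂ h unitDisk ∧ DifferentiableOn ℂ g unitDisk ∧ h 0 = 0 ∧ g 0 = 0 ∧
    ∀ z ∈ unitDisk, f z = h z + (starRingEnd ℂ) (g z)

/-- The class `ℱ_H^0(G)` of those `f = h + conj g ∈ ℋ` with `|h'/G' - 1| < 1 - |g'/G'|` in the
unit disk. -/
def classFH (G : ℂ → ℂ) : Set (ℂ → ℂ) :=
  {f | f ∈ classH ∧ ∃ h g : ℂ → ℂ, IsCanonicalRep f h g ∧
    ∀ z ∈ unitDisk, ‖deriv h z / deriv G z - 1‖ < 1 - ‖deriv g z / deriv G z‖}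

/-- `f` is convex in `|z| < r`: it maps this disk univalently onto a convex set. -/
def ConvexInDisk (f : ℂ → ℂ) (r : ℝ) : Prop :=
  Set.InjOn f (Metric.ball 0 r) ∧ Convex ℝ (f '' Metric.ball 0 r)

/-- `r` is the radius of convexity of the family `𝓕` of functions in the unit disk: the largest
`r ∈ (0, 1]` such that every member of `𝓕` is convex in `|z| < ρ` for every `ρ ∈ (0, r]`. (For
harmonic functions, convexity in a disk need not be inherited by smaller concentric disks.) -/
def IsRadiusOfConvexity (𝓕 : Set (ℂ → ℂ)) (r : ℝ) : Prop :=
  IsGreatest {r : ℝ | 0 < r ∧ r ≤ 1 ∧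
    ∀ f ∈ 𝓕, ∀ ρ : ℝ, 0 < ρ → ρ ≤ r → ConvexInDisk f ρ} r

/-- `r` is the sharp radius of convexity of `ℱ_H^0(G)` with `G` ranging over the class `𝓖`: it is
the radius of convexity of the family of all `f ∈ ℱ_H^0(G)`, `G ∈ 𝓖`, and there is one extremal
`f` which is convex in no disk `|z| < ρ` with `r < ρ ≤ 1`. -/
def IsSharpRadiusFor (𝓖 : Set (ℂ → ℂ)) (r : ℝ) : Prop :=
  IsRadiusOfConvexity (⋃ G ∈ 𝓖, classFH G) r ∧
    ∃ G ∈ 𝓖, ∃ f ∈ classFH G, ∀ ρ : ℝ, r < ρ → ρ ≤ 1 → ¬ ConvexInDisk f ρ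

end HarmonicConvexity

/-! Let f = h + conj g lie in ℱ_H^0(G). For |ε| = 1 the analytic function F = h + εg satisfies F' =
G'(1 + ω) with ω = h'/G' - 1 + εg'/G', where |ω| < 1 and ω(0) = 0. Hence 1 + zF''/F' = (1 + zG''/G')
+ zω'/(1 + ω), and the Schwarz and Schwarz–Pick lemmas bound the last term by |z|/(1 - |z|). So
every rotation F is convex in a disk where Re(1 + zG''/G') > |z|/(1 - |z|). Convexity of all
rotations passes to f: at each boundary point one particular ε makes a supporting line for F into
one for f (`exists_supporting`, `convexInDisk_of_forall_rotation`).

It remains to bound Re(1 + zG''/G') from below on |z| = s and to compare with s/(1 - s). For 𝒮 and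
𝒮*, the area theorem, Bieberbach's coefficient bound and the Koebe transform give (1 - 4s + s²)/(1 -
s²). For 𝒦, the analytic criterion for convexity and the Carathéodory bound give (1 - s)/(1 + s).
For ℛ, Schwarz–Pick gives 1 - 2s/(1 - s²). For ℛ_{1/2}, writing G' = 1/(1 - w) reduces the
comparison to a quadratic in |1 - w| whose discriminant is the quartic of the theorem.

Sharpness uses an extremal G with g = 0 and f' = G'(1 + z), that is ω = z. At z = -x with x > r the
quantity 1 + zf''/f' is negative, which `re_nonneg_of_convexInDisk` forbids in any disk containing
-x where f is convex. -/

open Complex Metric Set Filter Topology MeasureTheory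
open scoped ComplexConjugate

namespace HarmonicConvexity

/-! ### Tangent lines of convex analytic curves -/

/-- A nonvanishing holomorphic function on a disk has a holomorphic logarithm. -/
theorem exists_log_on_ball {g : ℂ → ℂ} {R : ℝ} (hR : 0 < R)
    (hg : DifferentiableOn ℂ g (ball 0 R)) (hne : ∀ z ∈ ball (0 : ℂ) R, g z ≠ 0) :
    ∃ L : ℂ → ℂ, L 0 = log (g 0) ∧
      ∀ z ∈ ball (0 : ℂ) R, exp (L z) = g z ∧ HasDerivAt L (deriv g z / g z) z := by
  have h0 : (0 : ℂ) ∈ ball (0 : ℂ) R := mem_ball_self hR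
  have hd : DifferentiableOn ℂ (fun z => deriv g z / g z) (ball 0 R) :=
    (hg.deriv isOpen_ball).div hg hne
  obtain ⟨L, hL0, hL⟩ := hd.isExactOn_ball.with_val_at 0 (log (g 0))
  refine ⟨L, hL0, fun z hz => ⟨?_, hL z hz⟩⟩
  have hder : ∀ w ∈ ball (0 : ℂ) R, HasDerivAt (fun w => g w * exp (-L w)) 0 w := by
    intro w hw
    have h1 := (hg.differentiableAt (isOpen_ball.mem_nhds hw)).hasDerivAt
    have h2 := h1.mul (hL w hw).neg.cexp
    convert! h2 using 1
    field_simp [hne w hw]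
    ring
  have hc : g z * exp (-L z) = g 0 * exp (-L 0) :=
    isOpen_ball.is_const_of_deriv_eq_zero (convex_ball (0 : ℂ) R).isPreconnected
      (fun w hw => (hder w hw).differentiableAt.differentiableWithinAt)
      (fun w hw => (hder w hw).deriv) hz h0
  rw [hL0, exp_neg, exp_neg, exp_log (hne 0 h0), mul_inv_cancel₀ (hne 0 h0)] at hc
  have := exp_ne_zero (L z)
  field_simp at hc
  exact hc.symm

/-- A function on an interval that is differentiable with a derivative of the sign of
`-sin (Θ - a)`, where `Θ` increases from `a` to `a + 2π`, and that vanishes at both ends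
is negative inside. -/
theorem neg_of_deriv_eq_neg_mul_sin {u m Θ : ℝ → ℝ} {a b : ℝ}
    (hu : ∀ t, HasDerivAt u (-(m t * Real.sin (Θ t - Θ a))) t) (hm : ∀ t, 0 < m t)
    (hΘ : StrictMono Θ) (hc : Continuous Θ) (hΘb : Θ b = Θ a + 2 * Real.pi)
    (ha : u a = 0) (hb : u b = 0) {t : ℝ} (ht : t ∈ Ioo a b) : u t < 0 := by
  have hab : a < b := ht.1.trans ht.2
  have hpi := Real.pi_pos
  -- At c the angle has advanced by π: the sine is positive before c and negative after it, so u
  -- falls from 0 and then climbs back to 0.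
  obtain ⟨c, hcab, hΘc⟩ : ∃ c ∈ Icc a b, Θ c = Θ a + Real.pi :=
    intermediate_value_Icc hab.le hc.continuousOn ⟨by linarith, by linarith⟩
  have hcu : Continuous u := continuous_iff_continuousAt.2 fun t => (hu t).continuousAt
  have hanti : StrictAntiOn u (Icc a c) := by
    apply strictAntiOn_of_deriv_neg (convex_Icc a c) hcu.continuousOn
    intro x hx
    rw [interior_Icc] at hx
    rw [(hu x).deriv]
    have h1 := hΘ hx.1
    have h2 := hΘ hx.2
    have := Real.sin_pos_of_pos_of_lt_pi (x := Θ x - Θ a) (by linarith) (by linarith)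
    have := mul_pos (hm x) this
    linarith
  have hmono : StrictMonoOn u (Icc c b) := by
    apply strictMonoOn_of_deriv_pos (convex_Icc c b) hcu.continuousOn
    intro x hx
    rw [interior_Icc] at hx
    rw [(hu x).deriv]
    have h1 := hΘ hx.1
    have h2 := hΘ hx.2
    have h3 : Real.sin (Θ x - Θ a) = -Real.sin (Θ x - Θ a - Real.pi) := by
      rw [Real.sin_sub_pi, neg_neg]
    have := Real.sin_pos_of_pos_of_lt_pi (x := Θ x - Θ a - Real.pi) (by linarith) (by linarith)
    have := mul_pos (hm x) this
    rw [h3]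
    linarith
  rcases le_total t c with h | h
  · have := hanti ⟨le_rfl, hcab.1⟩ ⟨ht.1.le, h⟩ ht.1
    linarith
  · have := hmono ⟨h, ht.2.le⟩ ⟨hcab.2, le_rfl⟩ ht.2
    linarith

theorem exists_mul_exp_eq {z ζ : ℂ} (h : ‖ζ‖ = ‖z‖) (hne : ζ ≠ z) :
    ∃ t ∈ Ioo z.arg (z.arg + 2 * Real.pi), ζ = ‖z‖ * exp (t * I) := by
  have hz : ‖z‖ * exp (z.arg * I) = z := norm_mul_exp_arg_mul_I z
  have hζ : ‖z‖ * exp (ζ.arg * I) = ζ := by rw [← h]; exact norm_mul_exp_arg_mul_I ζ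
  have h1 := neg_pi_lt_arg z
  have h2 := arg_le_pi z
  have h3 := neg_pi_lt_arg ζ
  have h4 := arg_le_pi ζ
  rcases lt_trichotomy z.arg ζ.arg with h' | h' | h'
  · exact ⟨ζ.arg, ⟨h', by linarith⟩, hζ.symm⟩
  · rw [← h', hz] at hζ
    exact absurd hζ.symm hne
  · refine ⟨ζ.arg + 2 * Real.pi, ⟨by linarith, by linarith⟩, ?_⟩
    have : ((ζ.arg + 2 * Real.pi : ℝ) : ℂ) * I = ζ.arg * I + 2 * Real.pi * I := by
      push_cast; ring
    rw [this, exp_add, exp_two_pi_mul_I, mul_one, hζ]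

/-- A holomorphic function with `Re (1 + z F'' / F') > 0` maps each circle onto a curve which lies
strictly on one side of each of its tangents. -/
theorem re_conj_mul_sub_neg_of_norm_eq {F : ℂ → ℂ} {R : ℝ} (hF : DifferentiableOn ℂ F (ball 0 R))
    (hne : ∀ z ∈ ball (0 : ℂ) R, deriv F z ≠ 0)
    (hpos : ∀ z ∈ ball (0 : ℂ) R, 0 < (1 + z * (deriv (deriv F) z / deriv F z)).re)
    {z ζ : ℂ} (hz : ‖z‖ < R) (hζ : ‖ζ‖ = ‖z‖) (hζz : ζ ≠ z) :
    (conj (z * deriv F z) * (F ζ - F z)).re < 0 := by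
  have hz0 : z ≠ 0 := by
    rintro rfl
    exact hζz (norm_eq_zero.1 (by simpa using hζ))
  have hr : 0 < ‖z‖ := norm_pos_iff.2 hz0
  obtain ⟨L, -, hL⟩ := exists_log_on_ball (hr.trans hz) (hF.deriv isOpen_ball) hne
  set r := ‖z‖ with hrdef
  set c : ℝ → ℂ := fun t => r * exp (t * I) with hc
  have hcz : c z.arg = z := norm_mul_exp_arg_mul_I z
  have hcb : ∀ t, c t ∈ ball (0 : ℂ) R := by
    intro t
    simpa [hc, norm_exp_ofReal_mul_I, abs_of_pos hr] using hz
  have hcd : ∀ t : ℝ, HasDerivAt c (c t * I) t := by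
    intro t
    have h1 : HasDerivAt (fun s : ℝ => (s : ℂ) * I) (1 * I) t :=
      (hasDerivAt_id t).ofReal_comp.mul_const I
    have := (h1.cexp).const_mul (r : ℂ)
    convert! this using 1
    simp only [hc]; ring
  have hFd : ∀ w ∈ ball (0 : ℂ) R, HasDerivAt F (deriv F w) w := fun w hw =>
    (hF.differentiableAt (isOpen_ball.mem_nhds hw)).hasDerivAt
  have hFc : ∀ t, HasDerivAt (fun s => F (c s)) (deriv F (c t) * (c t * I)) t := fun t =>
    (hFd _ (hcb t)).comp t (hcd t)
  have hLc : ∀ t, HasDerivAt (fun s => L (c s))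
      (deriv (deriv F) (c t) / deriv F (c t) * (c t * I)) t := fun t =>
    (hL _ (hcb t)).2.comp t (hcd t)
  -- Θ is a continuous argument of zF'(z), hence of the outward normal, along the circle. Its
  -- derivative is Re(1 + zF''/F') > 0, and it gains exactly 2π per turn because L, defined on the
  -- whole disk, returns to its value.
  set Θ : ℝ → ℝ := fun t => t + (L (c t)).im with hΘ
  have hΘd : ∀ t, HasDerivAt Θ ((1 + c t * (deriv (deriv F) (c t) / deriv F (c t))).re) t := by
    intro t
    have h1 := (hasDerivAt_id t).add ((imCLM.hasFDerivAt.comp_hasDerivAt t (hLc t)))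
    convert! h1 using 1
    simp only [imCLM_apply, add_re, one_re]
    rw [← mul_assoc, mul_I_im, mul_comm]
  have hpi2 : ∀ t, c (t + 2 * Real.pi) = c t := by
    intro t
    have : ((t + 2 * Real.pi : ℝ) : ℂ) * I = t * I + 2 * Real.pi * I := by push_cast; ring
    simp only [hc]
    rw [this, exp_add, exp_two_pi_mul_I, mul_one]
  have hnorm : ∀ t, c t * deriv F (c t) =
      (r * Real.exp (L (c t)).re : ℝ) * exp (Θ t * I) := by
    intro t
    rw [← (hL _ (hcb t)).1]
    have : L (c t) = (L (c t)).re + (L (c t)).im * I := (re_add_im _).symm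
    conv_lhs => rw [this]
    simp only [hc, hΘ]
    push_cast
    rw [exp_add, add_mul, exp_add]
    ring
  obtain ⟨t, ht, hζt⟩ := exists_mul_exp_eq hζ hζz
  set m : ℝ → ℝ := fun s => (r * Real.exp (L (c z.arg)).re) * (r * Real.exp (L (c s)).re) with hm
  -- The signed distance to the tangent at z has derivative -m(s) sin(Θ(s) - Θ(arg z)), the form
  -- treated by `neg_of_deriv_eq_neg_mul_sin`.
  have hud : ∀ s, HasDerivAt (fun s => (conj (z * deriv F z) * (F (c s) - F z)).re)
      (-(m s * Real.sin (Θ s - Θ z.arg))) s := by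
    intro s
    have h1 := ((hFc s).sub_const (F z)).const_mul (conj (z * deriv F z))
    have h2 := reCLM.hasFDerivAt.comp_hasDerivAt s h1
    convert! h2 using 1
    have e1 : deriv F (c s) * (c s * I) =
      (r * Real.exp (L (c s)).re : ℝ) * exp (Θ s * I) * I := by rw [← hnorm s]; ring
    have e2 : conj (z * deriv F z) =
        (r * Real.exp (L (c z.arg)).re : ℝ) * exp (-(Θ z.arg : ℂ) * I) := by
      have := hnorm z.arg
      rw [hcz] at this
      rw [this, map_mul, conj_ofReal, ← exp_conj, map_mul, conj_ofReal, conj_I, hcz]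
      congr 2
      ring
    rw [e1, e2]
    have e3 : (((r * Real.exp (L (c z.arg)).re : ℝ) : ℂ) * exp (-(Θ z.arg : ℂ) * I)) *
        ((r * Real.exp (L (c s)).re : ℝ) * exp (Θ s * I) * I) =
        (m s : ℝ) * exp ((Θ s - Θ z.arg : ℝ) * I) * I := by
      have : (((Θ s - Θ z.arg : ℝ) : ℂ)) * I = -(Θ z.arg : ℂ) * I + Θ s * I := by
        push_cast; ring
      rw [this, exp_add]
      simp only [hm]
      push_cast
      ring
    rw [e3, reCLM_apply]
    change -(m s * Real.sin (Θ s - Θ z.arg)) = _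
    rw [mul_assoc (m s : ℂ), re_ofReal_mul, mul_I_re, exp_ofReal_mul_I_im]
    ring
  have hmpos : ∀ s, 0 < m s := fun s => by positivity
  have hmono : StrictMono Θ := strictMono_of_deriv_pos fun s => by
    rw [(hΘd s).deriv]
    exact hpos _ (hcb s)
  have hcont : Continuous Θ := continuous_iff_continuousAt.2 fun s => (hΘd s).continuousAt
  have key := neg_of_deriv_eq_neg_mul_sin (a := z.arg) (b := z.arg + 2 * Real.pi) hud hmpos hmono
    hcont (by simp only [hΘ, hpi2]; ring) (by simp [hcz]) (by simp [hpi2, hcz]) ht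
  have hct : c t = ζ := hζt.symm
  simpa [hct] using key

/-- The supporting line property of `re_conj_mul_sub_neg_of_norm_eq` inside the circle. -/
theorem re_conj_mul_sub_nonpos_of_norm_le {F : ℂ → ℂ} {R : ℝ}
    (hF : DifferentiableOn ℂ F (ball 0 R))
    (hne : ∀ z ∈ ball (0 : ℂ) R, deriv F z ≠ 0)
    (hpos : ∀ z ∈ ball (0 : ℂ) R, 0 < (1 + z * (deriv (deriv F) z / deriv F z)).re)
    {z ζ : ℂ} (hz : ‖z‖ < R) (hζ : ‖ζ‖ ≤ ‖z‖) :
    (conj (z * deriv F z) * (F ζ - F z)).re ≤ 0 := by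
  have hsub : closedBall (0 : ℂ) ‖z‖ ⊆ ball 0 R := closedBall_subset_ball hz
  -- The exponential turns the bound on a real part into a bound on a modulus, to which the maximum
  -- principle applies.
  set Φ : ℂ → ℂ := fun w => exp (conj (z * deriv F z) * (F w - F z)) with hΦ
  have hd : DifferentiableOn ℂ Φ (closedBall 0 ‖z‖) :=
    (((hF.mono hsub).sub_const (F z)).const_mul (conj (z * deriv F z))).cexp
  rcases eq_or_ne z 0 with rfl | hz0
  · simp
  have hbd : ‖Φ ζ‖ ≤ 1 := by
    refine norm_le_of_forall_mem_frontier_norm_le isBounded_ball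
      (hd.diffContOnCl_ball subset_rfl) ?_ (by
        rw [closure_ball _ (norm_pos_iff.2 hz0).ne']; simpa using hζ)
    intro w hw
    have hw' : ‖w‖ = ‖z‖ := by simpa using frontier_ball_subset_sphere hw
    rw [hΦ, norm_exp, Real.exp_le_one_iff]
    rcases eq_or_ne w z with rfl | hwz
    · simp
    · exact (re_conj_mul_sub_neg_of_norm_eq hF hne hpos hz hw' hwz).le
  rwa [hΦ, norm_exp, Real.exp_le_one_iff] at hbd

/-! ### From convex rotations to convex harmonic mappings -/

theorem re_conj_mul_sub_neg_of_mem_interior {K : Set ℂ} {n b x : ℂ} (hn : n ≠ 0)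
    (hK : ∀ k ∈ K, (conj n * (k - b)).re ≤ 0) (hx : x ∈ interior K) :
    (conj n * (x - b)).re < 0 := by
  -- An interior point can be pushed a little in the direction n without leaving K; were it on the
  -- line, it would cross to the wrong side.
  have hcont : Tendsto (fun τ : ℝ => x + τ * n) (𝓝[>] 0) (𝓝 x) := by
    have : Continuous fun τ : ℝ => x + τ * n := by fun_prop
    have h := this.tendsto 0
    simp only [ofReal_zero, zero_mul, add_zero] at h
    exact h.mono_left nhdsWithin_le_nhds
  have hev := hcont.eventually (mem_interior_iff_mem_nhds.1 hx)
  obtain ⟨τ, hτK, hτ⟩ := (hev.and self_mem_nhdsWithin).exists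
  have hτ' : 0 < τ := hτ
  have h1 := hK _ hτK
  have h2 : conj n * (x + τ * n - b) = conj n * (x - b) + (τ * normSq n : ℝ) := by
    push_cast
    rw [normSq_eq_conj_mul_self]
    ring
  rw [h2, add_re, ofReal_re] at h1
  have := mul_pos hτ' (normSq_pos.2 hn)
  linarith

/-- A closed set with an interior point and a supporting line at each boundary point is convex. -/
theorem convex_of_forall_supporting {K : Set ℂ} (hK : IsClosed K) (hint : (interior K).Nonempty)
    (hsupp : ∀ b ∈ K, b ∉ interior K → ∃ n : ℂ, n ≠ 0 ∧ ∀ k ∈ K, (conj n * (k - b)).re ≤ 0) :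
    Convex ℝ K := by
  rw [convex_iff_segment_subset]
  intro p hp q hq y hy
  by_contra hyK
  obtain ⟨x, hx⟩ := hint
  have hxK := interior_subset hx
  -- The segment from the interior point x to y ∉ K meets a boundary point b of K. Relative to the
  -- line at b, x is strictly inside and y weakly inside, so b can lie on the line only if b = y,
  -- which contradicts y ∉ K.
  obtain ⟨b, hbseg, hbK, hbint⟩ : ∃ b ∈ segment ℝ x y, b ∈ K ∧ b ∉ interior K := by
    by_contra! hcon
    obtain ⟨b, -, hb1, hb2⟩ := (convex_segment x y).isPreconnected (interior K) Kᶜ isOpen_interior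
      hK.isOpen_compl (fun b hb => or_iff_not_imp_right.2 fun h => hcon b hb (not_not.1 h))
      ⟨x, left_mem_segment ℝ x y, hx⟩ ⟨y, right_mem_segment ℝ x y, hyK⟩
    exact hb2 (interior_subset hb1)
  obtain ⟨n, hn, hsup⟩ := hsupp b hbK hbint
  have hxb := re_conj_mul_sub_neg_of_mem_interior hn hsup hx
  have hyb : (conj n * (y - b)).re ≤ 0 := by
    obtain ⟨s, t, hs, ht, hst, rfl⟩ := hy
    have h1 := mul_nonneg hs (neg_nonneg.2 (hsup p hp))
    have h2 := mul_nonneg ht (neg_nonneg.2 (hsup q hq))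
    have h3 : conj n * (s • p + t • q - b) =
        (s : ℝ) * (conj n * (p - b)) + (t : ℝ) * (conj n * (q - b)) := by
      have : (s : ℂ) + t = 1 := by exact_mod_cast hst
      simp only [real_smul]
      linear_combination (conj n * b) * this
    rw [h3, add_re, re_ofReal_mul, re_ofReal_mul]
    linarith
  obtain ⟨s, t, hs, ht, hst, hb⟩ := hbseg
  have h3 : (s : ℂ) * (conj n * (x - b)) + (t : ℂ) * (conj n * (y - b)) = 0 := by
    have : (s : ℂ) + t = 1 := by exact_mod_cast hst
    simp only [real_smul] at hb
    linear_combination (conj n) * hb - (conj n * b) * this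
  have h4 := congrArg re h3
  rw [add_re, re_ofReal_mul, re_ofReal_mul, zero_re] at h4
  have h5 := mul_nonneg ht (neg_nonneg.2 hyb)
  have hs0 : s = 0 := by
    by_contra h
    have := mul_pos (lt_of_le_of_ne hs (Ne.symm h)) (neg_pos.2 hxb)
    linarith
  apply hyK
  rw [hs0, zero_add] at hst
  rw [hs0, hst] at hb
  rw [zero_smul, one_smul, zero_add] at hb
  rwa [hb]

/-- A sense-preserving harmonic mapping `h + conj g` is open. -/
theorem map_nhds_add_conj {h g : ℂ → ℂ} {z : ℂ} (hh : AnalyticAt ℂ h z) (hg : AnalyticAt ℂ g z)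
    (hlt : ‖deriv g z‖ < ‖deriv h z‖) :
    map (fun w => h w + conj (g w)) (𝓝 z) = 𝓝 (h z + conj (g z)) := by
  have h1 := hh.hasStrictFDerivAt.restrictScalars ℝ
  have h2 := hg.hasStrictFDerivAt.restrictScalars ℝ
  have h3 := h1.add (conjCLE.toContinuousLinearMap.hasStrictFDerivAt.comp z h2)
  refine HasStrictFDerivAt.map_nhds_eq_of_surj h3 ?_
  rw [LinearMap.range_eq_top]
  set A := (ContinuousLinearMap.restrictScalars ℝ (fderiv ℂ h z) +
    conjCLE.toContinuousLinearMap ∘SL ContinuousLinearMap.restrictScalars ℝ (fderiv ℂ g z))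
  suffices hinj : Function.Injective A.toLinearMap from
    LinearMap.injective_iff_surjective.1 hinj
  -- The real differential is v ↦ h'v + conj(g'v); a nonzero kernel vector would force |h'| = |g'|.
  rw [← LinearMap.ker_eq_bot, LinearMap.ker_eq_bot']
  intro v hv
  have hv' : v * deriv h z + conj (v * deriv g z) = 0 := by
    simpa [A, fderiv_eq_smul_deriv] using hv
  have hv2 : ‖v‖ * ‖deriv h z‖ = ‖v‖ * ‖deriv g z‖ := by
    rw [← norm_mul, ← norm_mul, eq_neg_of_add_eq_zero_left hv', norm_neg, norm_conj]
  by_contra hv0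
  have := mul_lt_mul_of_pos_left hlt (norm_pos_iff.2 hv0)
  linarith

/-- If all the functions `h + ε g` with `|ε| = 1` satisfy the convexity condition, then the
images of circles under `h + conj g` have supporting lines. -/
theorem exists_supporting {h g : ℂ → ℂ} {R : ℝ}
    (hh : DifferentiableOn ℂ h (ball 0 R)) (hg : DifferentiableOn ℂ g (ball 0 R))
    (hlt : ∀ z ∈ ball (0 : ℂ) R, ‖deriv g z‖ < ‖deriv h z‖)
    (hpos : ∀ ε : ℂ, ‖ε‖ = 1 → ∀ z ∈ ball (0 : ℂ) R,
      0 < (1 + z * (deriv (deriv fun w => h w + ε * g w) z / deriv (fun w => h w + ε * g w) z)).re)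
    {z : ℂ} (hz : ‖z‖ < R) (hz0 : z ≠ 0) :
    ∃ n : ℂ, n ≠ 0 ∧ ∀ ζ : ℂ, ‖ζ‖ ≤ ‖z‖ →
      (conj n * (h ζ + conj (g ζ) - (h z + conj (g z)))).re ≤ 0 ∧ (‖ζ‖ = ‖z‖ → ζ ≠ z →
        (conj n * (h ζ + conj (g ζ) - (h z + conj (g z)))).re < 0) := by
  have hzb : z ∈ ball (0 : ℂ) R := by simpa using hz
  have hda : ∀ w ∈ ball (0 : ℂ) R, HasDerivAt h (deriv h w) w := fun w hw =>
    (hh.differentiableAt (isOpen_ball.mem_nhds hw)).hasDerivAt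
  have hdg : ∀ w ∈ ball (0 : ℂ) R, HasDerivAt g (deriv g w) w := fun w hw =>
    (hg.differentiableAt (isOpen_ball.mem_nhds hw)).hasDerivAt
  set a := z * deriv h z with ha
  set b := z * deriv g z with hb
  have hab : ‖b‖ < ‖a‖ := by
    rw [ha, hb, norm_mul, norm_mul]
    exact mul_lt_mul_of_pos_left (hlt z hzb) (norm_pos_iff.2 hz0)
  -- The tangent of t ↦ f(ze^{it}) at t = 0 is i(a - conj b), so n is normal to the image curve.
  set n := a - conj b with hn
  have hn0 : n ≠ 0 := by
    intro h0
    rw [sub_eq_zero.1 h0, norm_conj] at hab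
    exact lt_irrefl _ hab
  have hnpos : 0 < ‖n‖ := norm_pos_iff.2 hn0
  set u : ℂ := n / ‖n‖ with hu
  have hnC : (‖n‖ : ℂ) ≠ 0 := ofReal_ne_zero.2 hnpos.ne'
  have hu1 : ‖u‖ = 1 := by simp [hu, hnpos.ne']
  have huu : conj u * u = 1 := by
    rw [← normSq_eq_conj_mul_self, normSq_eq_norm_sq, hu1]; simp
  have hnu : n = ‖n‖ * u := by rw [hu]; field_simp
  -- With ε = u², conj u · εg = ug has the same real part as conj u · conj g. Thus F and f have the
  -- same component in the direction u.
  set F : ℂ → ℂ := fun w => h w + u ^ 2 * g w with hF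
  have hε : ‖u ^ 2‖ = 1 := by simp [hu1]
  have hFd : ∀ w ∈ ball (0 : ℂ) R, HasDerivAt F (deriv h w + u ^ 2 * deriv g w) w := fun w hw =>
    (hda w hw).add ((hdg w hw).const_mul _)
  have hFD : DifferentiableOn ℂ F (ball 0 R) := fun w hw =>
    (hFd w hw).differentiableAt.differentiableWithinAt
  have hFne : ∀ w ∈ ball (0 : ℂ) R, deriv F w ≠ 0 := by
    intro w hw h0
    rw [(hFd w hw).deriv] at h0
    have := hlt w hw
    rw [eq_neg_of_add_eq_zero_left h0, norm_neg, norm_mul, hε, one_mul] at this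
    exact lt_irrefl _ this
  have hFp := hpos _ hε
  set A := conj u * a with hA
  set B := u * b with hB
  have hAB : A - conj B = ‖n‖ := by
    have : A - conj B = conj u * n := by rw [hA, hB, hn, map_mul]; ring
    rw [this]
    conv_lhs => rw [hnu]
    linear_combination (‖n‖ : ℂ) * huu
  have hre := congrArg re hAB
  have him := congrArg im hAB
  simp only [sub_re, sub_im, conj_re, conj_im, ofReal_re, ofReal_im] at hre him
  have hnA : ‖A‖ = ‖a‖ := by rw [hA, norm_mul, norm_conj, hu1, one_mul]
  have hnB : ‖B‖ = ‖b‖ := by rw [hB, norm_mul, hu1, one_mul]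
  -- A - conj B is real and positive, so A and B have opposite imaginary parts and |A|² - |B|² = (Re
  -- A + Re B)(Re A - Re B). Hence A + B is a positive real κ, and zF'(z) = κu points along n.
  have hsq : normSq B < normSq A := by
    rw [normSq_eq_norm_sq, normSq_eq_norm_sq, hnA, hnB]
    exact pow_lt_pow_left₀ hab (norm_nonneg _) two_ne_zero
  rw [normSq_apply, normSq_apply] at hsq
  have himz : (A + B).im = 0 := by rw [add_im]; linarith
  have hκ : 0 < (A + B).re := by
    rw [add_re]
    have h1 : A.im * A.im = B.im * B.im := by
      have : A.im = -B.im := by linarith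
      rw [this]; ring
    have h2 : 0 < (A.re + B.re) * (A.re - B.re) := by nlinarith
    rw [hre] at h2
    exact (pos_iff_pos_of_mul_pos h2).2 hnpos
  set κ := (A + B).re with hκd
  have hABκ : A + B = κ := by
    apply Complex.ext <;> simp [himz, hκd]
  have hzF : conj (z * deriv F z) = κ * conj u := by
    rw [(hFd z hzb).deriv]
    have h1 : z * (deriv h z + u ^ 2 * deriv g z) = u * (A + B) := by
      rw [hA, hB, ha, hb]
      linear_combination (-(z * deriv h z)) * huu
    rw [h1, hABκ, map_mul, conj_ofReal, mul_comm]
  have key : ∀ ζ : ℂ, (conj n * (h ζ + conj (g ζ) - (h z + conj (g z)))).re =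
      ‖n‖ / κ * (conj (z * deriv F z) * (F ζ - F z)).re := by
    intro ζ
    have e1 : conj n = ‖n‖ * conj u := by
      conv_lhs => rw [hnu]
      rw [map_mul, conj_ofReal]
    have e2 : (conj u * (h ζ + conj (g ζ) - (h z + conj (g z)))).re =
        (conj u * (F ζ - F z)).re := by
      have : conj u * (F ζ - F z) = conj u * (h ζ - h z) + u * (g ζ - g z) := by
        simp only [hF]
        linear_combination (u * (g ζ - g z)) * huu
      rw [this]
      simp only [mul_re, add_re, sub_re, conj_re, conj_im, add_im, sub_im]
      ring
    rw [hzF, e1, mul_assoc, mul_assoc, re_ofReal_mul, re_ofReal_mul, e2]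
    field_simp
  have hc : 0 < ‖n‖ / κ := div_pos hnpos hκ
  refine ⟨n, hn0, fun ζ hζ => ⟨?_, fun h1 h2 => ?_⟩⟩
  · rw [key]
    exact mul_nonpos_of_nonneg_of_nonpos hc.le
      (re_conj_mul_sub_nonpos_of_norm_le hFD hFne hFp hz hζ)
  · rw [key]
    exact mul_neg_of_pos_of_neg hc (re_conj_mul_sub_neg_of_norm_eq hFD hFne hFp hz h1 h2)

/-- If `h` dominates `g` and all the functions `h + ε g` with `|ε| = 1` satisfy the convexity
condition in a disk, then `h + conj g` is convex in this disk. -/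
theorem convexInDisk_of_forall_rotation {f h g : ℂ → ℂ} {R : ℝ}
    (hh : DifferentiableOn ℂ h (ball 0 R)) (hg : DifferentiableOn ℂ g (ball 0 R))
    (hf : ∀ z ∈ ball (0 : ℂ) R, f z = h z + conj (g z))
    (hlt : ∀ z ∈ ball (0 : ℂ) R, ‖deriv g z‖ < ‖deriv h z‖)
    (hpos : ∀ ε : ℂ, ‖ε‖ = 1 → ∀ z ∈ ball (0 : ℂ) R,
      0 < (1 + z * (deriv (deriv fun w => h w + ε * g w) z /
        deriv (fun w => h w + ε * g w) z)).re) :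
    ConvexInDisk f R := by
  set f₀ : ℂ → ℂ := fun w => h w + conj (g w) with hf₀
  have hEq : EqOn f f₀ (ball 0 R) := hf
  have hmap : ∀ z ∈ ball (0 : ℂ) R, map f₀ (𝓝 z) = 𝓝 (f₀ z) := fun z hz =>
    map_nhds_add_conj (hh.analyticAt (isOpen_ball.mem_nhds hz))
      (hg.analyticAt (isOpen_ball.mem_nhds hz)) (hlt z hz)
  have hint : ∀ r < R, ∀ ζ : ℂ, ‖ζ‖ < r → f₀ ζ ∈ interior (f₀ '' closedBall 0 r) := by
    intro r hr ζ hζ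
    rw [mem_interior_iff_mem_nhds, ← hmap ζ (by simpa using hζ.trans hr)]
    exact image_mem_map (mem_of_superset (isOpen_ball.mem_nhds (by simpa using hζ))
      ball_subset_closedBall)
  -- A point inside the circle through z has its image in the interior, strictly within the
  -- supporting half-plane at f(z); another point of the circle is excluded by the strict
  -- inequality.
  have hne : ∀ z ζ : ℂ, ‖z‖ < R → ‖ζ‖ ≤ ‖z‖ → f₀ ζ = f₀ z → ζ = z := by
    intro z ζ hz hζ heq
    by_contra hζz
    have hz0 : z ≠ 0 := by
      rintro rfl
      exact hζz (norm_le_zero_iff.1 (by simpa using hζ))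
    obtain ⟨n, hn, hs⟩ := exists_supporting hh hg hlt hpos hz hz0
    have hzero : (conj n * (f₀ ζ - f₀ z)).re = 0 := by rw [heq]; simp
    rcases hζ.lt_or_eq with hlt' | heq'
    · have := re_conj_mul_sub_neg_of_mem_interior (b := f₀ z) hn (by
        rintro _ ⟨w, hw, rfl⟩
        exact (hs w (by simpa using hw)).1) (hint _ hz ζ hlt')
      linarith
    · have : (conj n * (f₀ ζ - f₀ z)).re < 0 := (hs ζ hζ).2 heq' hζz
      linarith
  have hconv : ∀ r, 0 < r → r < R → Convex ℝ (f₀ '' closedBall 0 r) := by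
    intro r hr hrR
    have hsub : closedBall (0 : ℂ) r ⊆ ball 0 R := closedBall_subset_ball hrR
    have hcont : ContinuousOn f₀ (closedBall 0 r) :=
      (hh.continuousOn.mono hsub).add (continuous_conj.comp_continuousOn (hg.continuousOn.mono hsub))
    refine convex_of_forall_supporting ((isCompact_closedBall _ _).image_of_continuousOn
      hcont).isClosed ⟨_, hint r hrR 0 (by simpa using hr)⟩ ?_
    rintro _ ⟨z, hz, rfl⟩ hzint
    -- By openness of f, boundary points of the image come only from the circle |z| = r, where
    -- supporting lines exist.
    have hz' : ‖z‖ ≤ r := by simpa using hz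
    have hzr : ‖z‖ = r := by
      by_contra hne'
      exact hzint (hint r hrR z (lt_of_le_of_ne hz' hne'))
    obtain ⟨n, hn, hs⟩ := exists_supporting hh hg hlt hpos (by rwa [hzr])
      (norm_pos_iff.1 (by rwa [hzr]))
    refine ⟨n, hn, ?_⟩
    rintro _ ⟨w, hw, rfl⟩
    exact (hs w (by rw [hzr]; simpa using hw)).1
  constructor
  · intro z hz ζ hζ heq
    rw [hEq hz, hEq hζ] at heq
    rcases le_total ‖z‖ ‖ζ‖ with h' | h'
    · exact hne ζ z (by simpa using hζ) h' heq
    · exact (hne z ζ (by simpa using hz) h' heq.symm).symm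
  · rw [hEq.image_eq, convex_iff_segment_subset]
    rintro _ ⟨z, hz, rfl⟩ _ ⟨w, hw, rfl⟩
    have hz' : ‖z‖ < R := by simpa using hz
    have hw' : ‖w‖ < R := by simpa using hw
    have hR : 0 < R := (norm_nonneg _).trans_lt hz'
    set r := (max ‖z‖ ‖w‖ + R) / 2 with hr
    have h1 := le_max_left ‖z‖ ‖w‖
    have h2 := le_max_right ‖z‖ ‖w‖
    have h3 : max ‖z‖ ‖w‖ < R := max_lt hz' hw'
    have h4 := norm_nonneg z
    have hrR : r < R := by rw [hr]; linarith
    refine ((hconv r (by rw [hr]; linarith) hrR).segment_subset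
      (mem_image_of_mem _ ?_) (mem_image_of_mem _ ?_)).trans
      (image_mono (closedBall_subset_ball hrR))
    · rw [mem_closedBall_zero_iff, hr]; linarith
    · rw [mem_closedBall_zero_iff, hr]; linarith

/-! ### Schwarz–Pick estimates and the perturbation of G -/

/-- The disk automorphism `ζ ↦ (ζ + a) / (1 + conj a ζ)`. -/
noncomputable def diskShift (a ζ : ℂ) : ℂ := (ζ + a) / (1 + conj a * ζ)

theorem one_add_conj_mul_ne_zero {a ζ : ℂ} (ha : ‖a‖ < 1) (hζ : ‖ζ‖ < 1) :
    1 + conj a * ζ ≠ 0 := by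
  intro h
  have h1 : ‖conj a * ζ‖ = 1 := by
    rw [eq_neg_of_add_eq_zero_right h, norm_neg, norm_one]
  rw [norm_mul, norm_conj] at h1
  have := mul_lt_mul'' ha hζ (norm_nonneg _) (norm_nonneg _)
  linarith

/-- The identity |1 + conj a ζ|² - |ζ + a|² = (1 - |a|²)(1 - |ζ|²) decides it. -/
theorem norm_diskShift_lt {a ζ : ℂ} (ha : ‖a‖ < 1) (hζ : ‖ζ‖ < 1) : ‖diskShift a ζ‖ < 1 := by
  rw [diskShift, norm_div, div_lt_one (norm_pos_iff.2 (one_add_conj_mul_ne_zero ha hζ))]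
  apply lt_of_pow_lt_pow_left₀ 2 (norm_nonneg _)
  have ha' : normSq a < 1 := by
    rw [normSq_eq_norm_sq]; exact pow_lt_one₀ (norm_nonneg _) ha two_ne_zero
  have hζ' : normSq ζ < 1 := by
    rw [normSq_eq_norm_sq]; exact pow_lt_one₀ (norm_nonneg _) hζ two_ne_zero
  rw [← normSq_eq_norm_sq, ← normSq_eq_norm_sq]
  rw [normSq_apply] at *
  simp only [normSq_apply, add_re, add_im, mul_re, mul_im, conj_re, conj_im, one_re, one_im] at *
  nlinarith [mul_pos (sub_pos.2 ha') (sub_pos.2 hζ')]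

theorem hasDerivAt_diskShift {a ζ : ℂ} (ha : ‖a‖ < 1) (hζ : ‖ζ‖ < 1) :
    HasDerivAt (diskShift a) ((1 - conj a * a) / (1 + conj a * ζ) ^ 2) ζ := by
  have h1 : HasDerivAt (fun w : ℂ => w + a) 1 ζ := (hasDerivAt_id ζ).add_const a
  have h2 : HasDerivAt (fun w : ℂ => 1 + conj a * w) (conj a * 1) ζ :=
    ((hasDerivAt_id ζ).const_mul (conj a)).const_add 1
  have := h1.div h2 (one_add_conj_mul_ne_zero ha hζ)
  convert! this using 1
  ring

theorem diskShift_injOn {a : ℂ} (ha : ‖a‖ < 1) : InjOn (diskShift a) (ball 0 1) := by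
  intro z hz w hw h
  have h1 := one_add_conj_mul_ne_zero ha (by simpa using hz)
  have h2 := one_add_conj_mul_ne_zero ha (by simpa using hw)
  rw [diskShift, diskShift, div_eq_div_iff h1 h2] at h
  have h3 : (z - w) * (1 - conj a * a) = 0 := by linear_combination h
  have h4 : (1 - conj a * a : ℂ) ≠ 0 := by
    rw [← normSq_eq_conj_mul_self, normSq_eq_norm_sq]
    have : ‖a‖ ^ 2 < 1 := pow_lt_one₀ (norm_nonneg _) ha two_ne_zero
    exact_mod_cast (sub_pos.2 this).ne'
  exact sub_eq_zero.1 ((mul_eq_zero.1 h3).resolve_right h4)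

@[simp] theorem diskShift_zero (a : ℂ) : diskShift a 0 = a := by simp [diskShift]

theorem diskShift_neg_self (a : ℂ) : diskShift (-a) a = 0 := by simp [diskShift]

/-- Conjugating ω by disk automorphisms gives Φ with Φ(0) = 0 and Φ'(0) = ω'(a)(1 - |a|²)/(1 -
|ω(a)|²), and the Schwarz lemma gives |Φ'(0)| ≤ 1. The strict bound on ω keeps the automorphism
centred at ω(a) nondegenerate. -/
theorem norm_deriv_mul_le_of_norm_lt {ω : ℂ → ℂ} (hω : DifferentiableOn ℂ ω (ball 0 1))
    (hb : ∀ z ∈ ball (0 : ℂ) 1, ‖ω z‖ < 1) {a : ℂ} (ha : ‖a‖ < 1) :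
    ‖deriv ω a‖ * (1 - ‖a‖ ^ 2) ≤ 1 - ‖ω a‖ ^ 2 := by
  have ha' : a ∈ ball (0 : ℂ) 1 := by simpa using ha
  set b := ω a with hbdef
  have hb1 : ‖b‖ < 1 := hb a ha'
  have hnb : ‖-b‖ < 1 := by rwa [norm_neg]
  set Φ : ℂ → ℂ := fun ζ => diskShift (-b) (ω (diskShift a ζ)) with hΦ
  have hTm : ∀ ζ ∈ ball (0 : ℂ) 1, diskShift a ζ ∈ ball (0 : ℂ) 1 := fun ζ hζ => by
    simpa using norm_diskShift_lt ha (by simpa using hζ)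
  have hd : ∀ ζ ∈ ball (0 : ℂ) 1, HasDerivAt Φ
      ((1 - conj (-b) * (-b)) / (1 + conj (-b) * ω (diskShift a ζ)) ^ 2 *
        (deriv ω (diskShift a ζ) * ((1 - conj a * a) / (1 + conj a * ζ) ^ 2))) ζ := by
    intro ζ hζ
    have h1 := hasDerivAt_diskShift ha (by simpa using hζ : ‖ζ‖ < 1)
    have h2 := (hω.differentiableAt (isOpen_ball.mem_nhds (hTm ζ hζ))).hasDerivAt
    exact (hasDerivAt_diskShift hnb (hb _ (hTm ζ hζ))).comp ζ (h2.comp ζ h1)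
  have h0 : (0 : ℂ) ∈ ball (0 : ℂ) 1 := by simp
  have hle := norm_deriv_le_one_of_mapsTo_ball (f := Φ) (c := 0) (R := 1)
    (fun ζ hζ => (hd ζ hζ).differentiableAt.differentiableWithinAt) (by
      have : Φ 0 = 0 := by simp [hΦ, hbdef, diskShift_neg_self]
      rw [this]
      intro ζ hζ
      simpa using (norm_diskShift_lt hnb (hb _ (hTm ζ hζ))).le) one_pos
  rw [(hd 0 h0).deriv] at hle
  have hbp : 0 < 1 - ‖b‖ ^ 2 := sub_pos.2 (pow_lt_one₀ (norm_nonneg _) hb1 two_ne_zero)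
  have hap : 0 < 1 - ‖a‖ ^ 2 := sub_pos.2 (pow_lt_one₀ (norm_nonneg _) ha two_ne_zero)
  have ea : (1 - conj a * a : ℂ) = ((1 - ‖a‖ ^ 2 : ℝ) : ℂ) := by
    rw [← normSq_eq_conj_mul_self, normSq_eq_norm_sq]; push_cast; ring
  have eb : (1 - conj b * b : ℂ) = ((1 - ‖b‖ ^ 2 : ℝ) : ℂ) := by
    rw [← normSq_eq_conj_mul_self, normSq_eq_norm_sq]; push_cast; ring
  have e : (1 - conj (-b) * (-b)) / (1 + conj (-b) * ω (diskShift a 0)) ^ 2 *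
        (deriv ω (diskShift a 0) * ((1 - conj a * a) / (1 + conj a * 0) ^ 2)) =
      deriv ω a * ((1 - ‖a‖ ^ 2 : ℝ) : ℂ) / ((1 - ‖b‖ ^ 2 : ℝ) : ℂ) := by
    have hb0 : ((1 - ‖b‖ ^ 2 : ℝ) : ℂ) ≠ 0 := ofReal_ne_zero.2 hbp.ne'
    rw [diskShift_zero, ← hbdef, ea, map_neg, neg_mul_neg, neg_mul, ← sub_eq_add_neg, eb]
    field_simp
    ring
  rw [e, norm_div, norm_mul, norm_real, norm_real, Real.norm_of_nonneg hap.le,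
    Real.norm_of_nonneg hbp.le, div_le_one hbp] at hle
  exact hle

/-- The **Schwarz–Pick lemma** for the derivative. -/
theorem norm_deriv_mul_le_of_norm_le {ω : ℂ → ℂ} (hω : DifferentiableOn ℂ ω (ball 0 1))
    (hb : ∀ z ∈ ball (0 : ℂ) 1, ‖ω z‖ ≤ 1) {a : ℂ} (ha : ‖a‖ < 1) :
    ‖deriv ω a‖ * (1 - ‖a‖ ^ 2) ≤ 1 - ‖ω a‖ ^ 2 := by
  have ha' : a ∈ ball (0 : ℂ) 1 := by simpa using ha
  -- The strict version applies to tω for 0 < t < 1; then t tends to 1.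
  have hev : ∀ᶠ t : ℝ in 𝓝[<] 1,
      t * ‖deriv ω a‖ * (1 - ‖a‖ ^ 2) ≤ 1 - (t * ‖ω a‖) ^ 2 := by
    filter_upwards [Ioo_mem_nhdsLT (zero_lt_one' ℝ)] with t ht
    have h := norm_deriv_mul_le_of_norm_lt (ω := fun z => (t : ℂ) * ω z) (hω.const_mul _)
      (fun z hz => by
        rw [norm_mul, norm_real, Real.norm_of_nonneg ht.1.le]
        exact (mul_le_mul_of_nonneg_left (hb z hz) ht.1.le).trans_lt (by simpa using ht.2)) ha
    rw [deriv_const_mul _ (hω.differentiableAt (isOpen_ball.mem_nhds ha')), norm_mul, norm_mul,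
      norm_real, Real.norm_of_nonneg ht.1.le] at h
    exact h
  have h1 : Tendsto (fun t : ℝ => t * ‖deriv ω a‖ * (1 - ‖a‖ ^ 2)) (𝓝[<] 1)
      (𝓝 (1 * ‖deriv ω a‖ * (1 - ‖a‖ ^ 2))) :=
    (Continuous.tendsto (by fun_prop) 1).mono_left nhdsWithin_le_nhds
  have h2 : Tendsto (fun t : ℝ => 1 - (t * ‖ω a‖) ^ 2) (𝓝[<] 1) (𝓝 (1 - (1 * ‖ω a‖) ^ 2)) :=
    (Continuous.tendsto (by fun_prop) 1).mono_left nhdsWithin_le_nhds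
  simpa using le_of_tendsto_of_tendsto h1 h2 hev

/-- Schwarz–Pick gives |ω'|(1 - |z|²) ≤ (1 - |ω|)(1 + |ω|), Schwarz replaces 1 + |ω| by 1 + |z|, and
|1 + ω| ≥ 1 - |ω| cancels the remaining factor. Equality occurs for ω = z on the negative radius,
hence the choice of extremal function below. -/
theorem norm_mul_deriv_div_one_add_le {ω : ℂ → ℂ} (hω : DifferentiableOn ℂ ω (ball 0 1))
    (hb : ∀ z ∈ ball (0 : ℂ) 1, ‖ω z‖ < 1) (h0 : ω 0 = 0) {z : ℂ} (hz : ‖z‖ < 1) :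
    ‖z * (deriv ω z / (1 + ω z))‖ ≤ ‖z‖ / (1 - ‖z‖) := by
  have hz' : z ∈ ball (0 : ℂ) 1 := by simpa using hz
  have h1 := norm_deriv_mul_le_of_norm_lt hω hb hz
  have h2 : ‖ω z‖ ≤ ‖z‖ :=
    norm_le_norm_of_mapsTo_ball hω (fun w hw => by simpa using (hb w hw).le) h0 hz
  have h3 := hb z hz'
  have h4 : 1 - ‖ω z‖ ≤ ‖1 + ω z‖ := by
    have := norm_sub_norm_le (1 : ℂ) (-ω z)
    rwa [norm_one, norm_neg, sub_neg_eq_add] at this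
  have h5 : 0 < 1 - ‖ω z‖ := by linarith
  have h6 : 0 < 1 - ‖z‖ := by linarith
  have h7 : ‖deriv ω z‖ * (1 - ‖z‖) ≤ 1 - ‖ω z‖ := by
    have hp : 0 < 1 + ‖z‖ := by positivity
    have : (‖deriv ω z‖ * (1 - ‖z‖)) * (1 + ‖z‖) ≤ (1 - ‖ω z‖) * (1 + ‖z‖) := by
      nlinarith [mul_le_mul_of_nonneg_left h2 h5.le]
    exact le_of_mul_le_mul_right this hp
  rw [norm_mul, norm_div, div_eq_mul_inv ‖z‖]
  refine mul_le_mul_of_nonneg_left ?_ (norm_nonneg _)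
  rw [← one_div, div_le_div_iff₀ (h5.trans_le h4) h6]
  linarith

theorem deriv_eq_of_mem_classH {f h g : ℂ → ℂ} (hf : f ∈ classH) (hr : IsCanonicalRep f h g) :
    deriv h 0 = 1 ∧ deriv g 0 = 0 := by
  obtain ⟨hh, hg, -, -, hfe⟩ := hr
  obtain ⟨-, -, hid⟩ := hf
  have hU : unitDisk ∈ 𝓝 (0 : ℂ) := ball_mem_nhds _ one_pos
  have h1 := (hh.differentiableAt hU).hasFDerivAt.restrictScalars ℝ
  have h2 := (hg.differentiableAt hU).hasFDerivAt.restrictScalars ℝ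
  have h3 := h1.add (conjCLE.toContinuousLinearMap.hasFDerivAt.comp 0 h2)
  have h4 : f =ᶠ[𝓝 0] (h + fun x => conjCLE (g x)) := by
    filter_upwards [hU] with z hz
    simpa using hfe z hz
  have h5 := h4.fderiv_eq (𝕜 := ℝ)
  have h6 := h3.fderiv
  simp only [Function.comp_def] at h6
  have h7 := (hid.symm.trans h5).trans h6
  -- Evaluation at 1 and at I gives h' + conj g' = 1 and h' - conj g' = 1.
  have e1 := DFunLike.congr_fun h7 1
  have e2 := DFunLike.congr_fun h7 I
  simp [fderiv_eq_smul_deriv] at e1 e2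
  have e3 : deriv h 0 - conj (deriv g 0) = 1 := by
    have := I_ne_zero
    apply mul_left_cancel₀ this
    linear_combination -e2
  have e4 : deriv h 0 = 1 := by linear_combination (-e1 + e3) / 2
  refine ⟨e4, ?_⟩
  have : conj (deriv g 0) = 0 := by linear_combination (-e1 - e3) / 2
  simpa using this

/-- Every `f` in `ℱ_H^0(G)` is convex in a disk in which `Re (1 + z G'' / G')` exceeds
`|z| / (1 - |z|)`. -/
theorem convexInDisk_of_mem_classFH {G f : ℂ → ℂ} {ρ : ℝ} (hG : G ∈ classA) (hf : f ∈ classFH G)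
    (hρ : ρ ≤ 1)
    (hpos : (∀ z ∈ unitDisk, deriv G z ≠ 0) → ∀ z ∈ ball (0 : ℂ) ρ,
      ‖z‖ / (1 - ‖z‖) < (1 + z * (deriv (deriv G) z / deriv G z)).re) :
    ConvexInDisk f ρ := by
  obtain ⟨hfH, h, g, hr, hlt⟩ := hf
  obtain ⟨hh0, hg0⟩ := deriv_eq_of_mem_classH hfH hr
  obtain ⟨hh, hg, -, -, hfe⟩ := hr
  obtain ⟨hGd, hG0, hG1⟩ := hG
  -- If G'(z) = 0, both quotients take the value 0 and the defining inequality becomes 1 < 1.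
  have hne : ∀ z ∈ unitDisk, deriv G z ≠ 0 := by
    intro z hz h0
    have := hlt z hz
    simp [h0] at this
  have hsub : ball (0 : ℂ) ρ ⊆ unitDisk := ball_subset_ball hρ
  have hU : IsOpen unitDisk := isOpen_ball
  refine convexInDisk_of_forall_rotation (hh.mono hsub) (hg.mono hsub)
    (fun z hz => hfe z (hsub hz)) ?_ ?_
  · intro z hz
    have h1 := hlt z (hsub hz)
    have h2 : ‖deriv g z / deriv G z‖ < ‖deriv h z / deriv G z‖ := by
      have := norm_sub_norm_le (1 : ℂ) (1 - deriv h z / deriv G z)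
      rw [norm_one, norm_sub_rev 1, sub_sub_cancel] at this
      linarith
    rw [norm_div, norm_div] at h2
    exact (div_lt_div_iff_of_pos_right (norm_pos_iff.2 (hne z (hsub hz)))).1 h2
  · intro ε hε z hz
    set ω : ℂ → ℂ := fun w => deriv h w / deriv G w - 1 + ε * (deriv g w / deriv G w) with hω
    have hGd' := hGd.deriv hU
    have hωd : DifferentiableOn ℂ ω unitDisk :=
      (((hh.deriv hU).div hGd' hne).sub_const 1).add
        (((hg.deriv hU).div hGd' hne).const_mul ε)
    have hωb : ∀ w ∈ unitDisk, ‖ω w‖ < 1 := by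
      intro w hw
      have h1 := hlt w hw
      have h2 := norm_add_le (deriv h w / deriv G w - 1) (ε * (deriv g w / deriv G w))
      rw [norm_mul, hε, one_mul] at h2
      exact h2.trans_lt (by linarith)
    have hω0 : ω 0 = 0 := by simp [hω, hh0, hg0, hG1]
    have hF' : ∀ w ∈ unitDisk, deriv (fun w => h w + ε * g w) w = deriv G w * (1 + ω w) := by
      intro w hw
      have h1 := (hh.differentiableAt (hU.mem_nhds hw)).hasDerivAt
      have h2 := (hg.differentiableAt (hU.mem_nhds hw)).hasDerivAt
      have h3 : deriv (fun w => h w + ε * g w) w = deriv h w + ε * deriv g w :=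
        (h1.add (h2.const_mul ε)).deriv
      rw [h3]
      have := hne w hw
      simp only [hω]
      field_simp
      ring
    have hzU := hsub hz
    have hF'' : deriv (deriv fun w => h w + ε * g w) z =
        deriv (deriv G) z * (1 + ω z) + deriv G z * deriv ω z := by
      have he : (deriv fun w => h w + ε * g w) =ᶠ[𝓝 z] fun w => deriv G w * (1 + ω w) := by
        filter_upwards [hU.mem_nhds hzU] with w hw using hF' w hw
      rw [he.deriv_eq]
      have h1 := (hGd'.differentiableAt (hU.mem_nhds hzU)).hasDerivAt
      have h2 := (hωd.differentiableAt (hU.mem_nhds hzU)).hasDerivAt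
      exact (h1.mul (h2.const_add 1)).deriv
    have hω1 : 1 + ω z ≠ 0 := by
      intro h0
      have := hωb z hzU
      rw [eq_neg_of_add_eq_zero_right h0, norm_neg, norm_one] at this
      exact lt_irrefl _ this
    have e : 1 + z * (deriv (deriv fun w => h w + ε * g w) z / deriv (fun w => h w + ε * g w) z) =
        (1 + z * (deriv (deriv G) z / deriv G z)) + z * (deriv ω z / (1 + ω z)) := by
      rw [hF'', hF' z hzU]
      have := hne z hzU
      field_simp
      ring
    rw [e, add_re]
    have h1 := hpos hne z hz
    have h2 := norm_mul_deriv_div_one_add_le hωd hωb hω0 (by simpa [unitDisk] using hzU)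
    have h3 := neg_le_of_abs_le (abs_re_le_norm (z * (deriv ω z / (1 + ω z))))
    linarith

/-! ### The analytic criterion for convexity, and the Carathéodory bound -/

/-- A function in terms of its difference quotient at the origin. -/
theorem eq_add_mul_dslope (φ : ℂ → ℂ) (z : ℂ) : φ z = φ 0 + z * dslope φ 0 z := by
  have := sub_smul_dslope φ 0 z
  simp only [sub_zero, smul_eq_mul] at this
  rw [this]
  ring

theorem analyticAt_dslope {φ : ℂ → ℂ} (hφ : AnalyticAt ℂ φ 0) : AnalyticAt ℂ (dslope φ 0) 0 := by
  obtain ⟨p, hp⟩ := hφ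
  exact ⟨_, hp.has_fpower_series_dslope_fslope⟩

theorem deriv_deriv_eq_two_mul_deriv_dslope {φ : ℂ → ℂ} (hφ : AnalyticAt ℂ φ 0) :
    deriv (deriv φ) 0 = 2 * deriv (dslope φ 0) 0 := by
  have ha1 := analyticAt_dslope hφ
  set φ₁ := dslope φ 0 with hφ₁
  have h1 : deriv φ =ᶠ[𝓝 0] fun z => φ₁ z + z * deriv φ₁ z := by
    filter_upwards [ha1.eventually_analyticAt] with z hz
    have h := ((hasDerivAt_id z).mul hz.differentiableAt.hasDerivAt).const_add (φ 0)
    have he : φ = fun z => φ 0 + z * φ₁ z := funext (eq_add_mul_dslope φ)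
    have hder : HasDerivAt φ (1 * φ₁ z + z * deriv φ₁ z) z := by
      rw [he]; exact h
    rw [hder.deriv, one_mul]
  rw [h1.deriv_eq]
  have h4 := ha1.differentiableAt.hasDerivAt.add
    ((hasDerivAt_id (0 : ℂ)).mul ha1.deriv.differentiableAt.hasDerivAt)
  have h5 : deriv (fun z => φ₁ z + z * deriv φ₁ z) 0 = deriv φ₁ 0 + (1 * deriv φ₁ 0 +
    0 * deriv (deriv φ₁) 0) := h4.deriv
  rw [h5]
  ring

/-- The second symmetric difference quotients of an analytic function tend to its second
derivative. -/
theorem tendsto_second_symm_diff {φ : ℂ → ℂ} (hφ : AnalyticAt ℂ φ 0) :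
    Tendsto (fun t : ℝ => (φ t + φ (-t) - 2 * φ 0) / (t : ℂ) ^ 2) (𝓝[≠] 0)
      (𝓝 (deriv (deriv φ) 0)) := by
  have ha1 := analyticAt_dslope hφ
  set φ₁ := dslope φ 0 with hφ₁
  set φ₂ := dslope φ₁ 0 with hφ₂
  have e1 : ∀ z, φ z = φ 0 + z * φ₁ z := eq_add_mul_dslope φ
  have e2 : ∀ z, φ₁ z = φ₁ 0 + z * φ₂ z := eq_add_mul_dslope φ₁
  have hd : deriv (deriv φ) 0 = 2 * φ₂ 0 := by
    rw [deriv_deriv_eq_two_mul_deriv_dslope hφ, hφ₂, dslope_same]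
  have hc2 : ContinuousAt φ₂ 0 := continuousAt_dslope_same.2 ha1.differentiableAt
  have hlim : Tendsto (fun t : ℝ => φ₂ t + φ₂ (-t)) (𝓝[≠] 0) (𝓝 (φ₂ 0 + φ₂ 0)) := by
    have h1 : Tendsto (fun t : ℝ => (t : ℂ)) (𝓝[≠] 0) (𝓝 0) :=
      (continuous_ofReal.tendsto' 0 0 ofReal_zero).mono_left nhdsWithin_le_nhds
    have h2 : Tendsto (fun t : ℝ => -(t : ℂ)) (𝓝[≠] 0) (𝓝 0) := by simpa using h1.neg
    exact (hc2.tendsto.comp h1).add (hc2.tendsto.comp h2)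
  rw [hd, two_mul (φ₂ 0)]
  refine hlim.congr' ?_
  filter_upwards [self_mem_nhdsWithin] with t ht
  have ht' : (t : ℂ) ≠ 0 := ofReal_ne_zero.2 ht
  rw [eq_div_iff (pow_ne_zero 2 ht'), e1 t, e1 (-t), e2 t, e2 (-t)]
  ring

/-- The inverse of a univalent function with nonvanishing derivative is holomorphic. -/
theorem hasDerivAt_invFunOn {F : ℂ → ℂ} {U : Set ℂ} (hU : IsOpen U) (hF : DifferentiableOn ℂ F U)
    (hinj : InjOn F U) {z : ℂ} (hz : z ∈ U) (hne : deriv F z ≠ 0) :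
    HasDerivAt (Function.invFunOn F U) (deriv F z)⁻¹ (F z) := by
  have hleft : ∀ w ∈ U, Function.invFunOn F U (F w) = w := fun w hw =>
    hinj.leftInvOn_invFunOn hw
  have hst := (hF.analyticAt (hU.mem_nhds hz)).hasStrictDerivAt
  have hmap := hst.map_nhds_eq hne
  have hcont : ContinuousAt (Function.invFunOn F U) (F z) := by
    rw [ContinuousAt, hleft z hz, ← hmap, tendsto_map'_iff]
    refine tendsto_id.congr' ?_
    filter_upwards [hU.mem_nhds hz] with w hw using (hleft w hw).symm
  refine HasDerivAt.of_local_left_inverse hcont (by rw [hleft z hz]; exact hst.hasDerivAt) hne ?_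
  rw [← hmap, eventually_map]
  filter_upwards [hU.mem_nhds hz] with w hw
  rw [hleft w hw]

/-- A convex univalent function satisfies `Re (1 + z F'' / F') ≥ 0`. -/
theorem re_nonneg_of_convexInDisk {F : ℂ → ℂ} {R : ℝ} (hF : DifferentiableOn ℂ F (ball 0 R))
    (hne : ∀ z ∈ ball (0 : ℂ) R, deriv F z ≠ 0) (hconv : ConvexInDisk F R)
    {z : ℂ} (hz : ‖z‖ < R) : 0 ≤ (1 + z * (deriv (deriv F) z / deriv F z)).re := by
  obtain ⟨hinj, hcon⟩ := hconv
  rcases eq_or_ne z 0 with rfl | hz0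
  · simp
  have hzb : z ∈ ball (0 : ℂ) R := by simpa using hz
  have hR : 0 < R := (norm_nonneg _).trans_lt hz
  set J := Function.invFunOn F (ball (0 : ℂ) R) with hJ
  have hJF : ∀ w ∈ ball (0 : ℂ) R, J (F w) = w := fun w hw => hinj.leftInvOn_invFunOn hw
  have hJd : ∀ w ∈ F '' ball (0 : ℂ) R, DifferentiableAt ℂ J w := by
    rintro _ ⟨w, hw, rfl⟩
    exact (hasDerivAt_invFunOn isOpen_ball hF hinj hw (hne w hw)).differentiableAt
  have hJm : ∀ w ∈ F '' ball (0 : ℂ) R, J w ∈ ball (0 : ℂ) R := by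
    rintro _ ⟨w, hw, rfl⟩
    rwa [hJF w hw]
  have hrot : ∀ (t : ℝ), ∀ w ∈ ball (0 : ℂ) R, w * exp (I * t) ∈ ball (0 : ℂ) R := by
    intro t w hw
    rw [mem_ball_zero_iff, norm_mul, mul_comm I, norm_exp_ofReal_mul_I, mul_one]
    simpa using hw
  have hrotd : ∀ t : ℝ, DifferentiableOn ℂ (fun w => F (w * exp (I * t))) (ball 0 R) := fun t =>
    hF.comp (by fun_prop) (hrot t)
  -- Midpoints of F(we^{it}) and F(we^{-it}) stay in the convex image, so F⁻¹ ∘ M_t is a self-map of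
  -- the disk fixing 0 and the Schwarz lemma applies. Since M_t(z) - F(z) is of order t², dividing
  -- by t² and letting t → 0 gives a second-order condition at z.
  set M : ℝ → ℂ → ℂ := fun t w =>
    (1 / 2 : ℝ) • F (w * exp (I * t)) + (1 / 2 : ℝ) • F (w * exp (I * (-t : ℝ))) with hM
  have hMm : ∀ (t : ℝ), ∀ w ∈ ball (0 : ℂ) R, M t w ∈ F '' ball (0 : ℂ) R := fun t w hw =>
    hcon (mem_image_of_mem _ (hrot t w hw)) (mem_image_of_mem _ (hrot (-t) w hw))
      (by norm_num) (by norm_num) (by norm_num)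
  have hMd : ∀ t : ℝ, DifferentiableOn ℂ (M t) (ball 0 R) := fun t =>
    ((hrotd t).const_smul (1 / 2 : ℝ)).add ((hrotd (-t)).const_smul (1 / 2 : ℝ))
  have hschwarz : ∀ t : ℝ, ‖J (M t z)‖ ≤ ‖z‖ := by
    intro t
    refine norm_le_norm_of_mapsTo_ball (R := R) (f := fun w => J (M t w)) ?_ ?_ ?_ hz
    · intro w hw
      exact ((hJd _ (hMm t w hw)).comp w ((hMd t).differentiableAt
        (isOpen_ball.mem_nhds hw))).differentiableWithinAt
    · intro w hw
      exact ball_subset_closedBall (hJm _ (hMm t w hw))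
    · have : M t 0 = F 0 := by
        simp only [hM, zero_mul, real_smul]
        push_cast
        ring
      simp only [this]
      exact hJF 0 (mem_ball_self hR)
  set φ : ℂ → ℂ := fun ζ => F (z * exp (I * ζ)) with hφ
  have hφ0 : φ 0 = F z := by simp [hφ]
  have hexp : ∀ ζ : ℂ, HasDerivAt (fun ζ => z * exp (I * ζ)) (z * exp (I * ζ) * I) ζ := by
    intro ζ
    have h1 : HasDerivAt (fun ζ : ℂ => I * ζ) (I * 1) ζ := (hasDerivAt_id ζ).const_mul I
    convert! h1.cexp.const_mul z using 1
    ring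
  have hev : ∀ᶠ ζ : ℂ in 𝓝 0, z * exp (I * ζ) ∈ ball (0 : ℂ) R := by
    have : ContinuousAt (fun ζ : ℂ => z * exp (I * ζ)) 0 := (hexp 0).continuousAt
    exact this.eventually_mem (isOpen_ball.mem_nhds (by simpa using hz))
  have hφd : ∀ᶠ ζ : ℂ in 𝓝 0,
      HasDerivAt φ (deriv F (z * exp (I * ζ)) * (z * exp (I * ζ) * I)) ζ := by
    filter_upwards [hev] with ζ hζ
    exact (hF.differentiableAt (isOpen_ball.mem_nhds hζ)).hasDerivAt.comp ζ (hexp ζ)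
  have hφa : AnalyticAt ℂ φ 0 := analyticAt_iff_eventually_differentiableAt.2
    (hφd.mono fun ζ h => h.differentiableAt)
  have hφ2 : deriv (deriv φ) 0 = -(z * deriv F z + z ^ 2 * deriv (deriv F) z) := by
    have h1 : deriv φ =ᶠ[𝓝 0] fun ζ => deriv F (z * exp (I * ζ)) * (z * exp (I * ζ) * I) :=
      hφd.mono fun ζ h => h.deriv
    rw [h1.deriv_eq]
    have h2 : HasDerivAt (deriv F) (deriv (deriv F) z) (z * exp (I * 0)) := by
      simpa using ((hF.deriv isOpen_ball).differentiableAt (isOpen_ball.mem_nhds hzb)).hasDerivAt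
    have h3 := (h2.comp 0 (hexp 0)).mul ((hexp 0).mul_const I)
    have h4 : deriv (fun ζ => deriv F (z * exp (I * ζ)) * (z * exp (I * ζ) * I)) 0 = _ := h3.deriv
    rw [h4]
    simp only [mul_zero, exp_zero, mul_one, Function.comp_apply]
    linear_combination (z * deriv F z + z ^ 2 * deriv (deriv F) z) * I_mul_I
  have hMφ : ∀ t : ℝ, M t z - F z = (φ t + φ (-t) - 2 * φ 0) / 2 := by
    intro t
    simp only [hM, hφ, real_smul]
    push_cast
    simp
    ring
  have hlim1 : Tendsto (fun t : ℝ => (M t z - F z) / (t : ℂ) ^ 2) (𝓝[≠] 0)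
      (𝓝 (-(z * deriv F z + z ^ 2 * deriv (deriv F) z) / 2)) := by
    have := (tendsto_second_symm_diff hφa).div_const 2
    rw [hφ2] at this
    refine this.congr fun t => ?_
    rw [hMφ]
    ring
  have hMc : Tendsto (fun t : ℝ => M t z) (𝓝[≠] 0) (𝓝 (F z)) := by
    have h1 : Tendsto (fun t : ℝ => (t : ℂ) ^ 2) (𝓝[≠] 0) (𝓝 0) := by
      have : Continuous fun t : ℝ => (t : ℂ) ^ 2 := by fun_prop
      exact (this.tendsto' 0 0 (by simp)).mono_left nhdsWithin_le_nhds
    have h2 := (hlim1.mul h1).add_const (F z)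
    rw [mul_zero, zero_add] at h2
    refine h2.congr' ?_
    filter_upwards [self_mem_nhdsWithin] with t ht
    have ht' : (t : ℂ) ≠ 0 := ofReal_ne_zero.2 ht
    field_simp
    ring
  have hJz := hasDerivAt_invFunOn isOpen_ball hF hinj hzb (hne z hzb)
  have hlim2 : Tendsto (fun t : ℝ => dslope J (F z) (M t z)) (𝓝[≠] 0) (𝓝 (deriv F z)⁻¹) := by
    have h1 := (continuousAt_dslope_same.2 hJz.differentiableAt).tendsto
    rw [dslope_same, hJz.deriv] at h1
    exact h1.comp hMc
  have hlim := ((hlim1.mul hlim2).const_mul (conj z))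
  have hre := (continuous_re.tendsto _).comp hlim
  have hle := le_of_tendsto hre (b := 0) (by
    filter_upwards [self_mem_nhdsWithin] with t ht
    have ht' : (t : ℂ) ≠ 0 := ofReal_ne_zero.2 ht
    have ht2 : 0 < t ^ 2 := by
      have : t ≠ 0 := ht
      positivity
    have e1 : conj z * ((M t z - F z) / (t : ℂ) ^ 2 * dslope J (F z) (M t z)) =
        ((t ^ 2)⁻¹ : ℝ) * (conj z * (J (M t z) - z)) := by
      have := sub_smul_dslope J (F z) (M t z)
      rw [smul_eq_mul, hJF z hzb] at this
      rw [← this]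
      push_cast
      ring
    simp only [Function.comp_apply]
    rw [e1, re_ofReal_mul]
    refine mul_nonpos_of_nonneg_of_nonpos (inv_nonneg.2 ht2.le) ?_
    have e2 : (conj z * (J (M t z) - z)).re = (conj z * J (M t z)).re - ‖z‖ ^ 2 := by
      rw [mul_sub, sub_re, ← normSq_eq_conj_mul_self, ofReal_re, normSq_eq_norm_sq]
    rw [e2]
    have h1 := re_le_norm (conj z * J (M t z))
    rw [norm_mul, norm_conj] at h1
    have h2 := mul_le_mul_of_nonneg_left (hschwarz t) (norm_nonneg z)
    nlinarith)
  -- The limit of Re(conj z (F⁻¹(M_t(z)) - z))/t² is -(|z|²/2) Re(1 + zF''/F'), and Schwarz makes it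
  -- nonpositive.
  have e3 : conj z * (-(z * deriv F z + z ^ 2 * deriv (deriv F) z) / 2 * (deriv F z)⁻¹) =
      ((-(‖z‖ ^ 2 / 2) : ℝ) : ℂ) * (1 + z * (deriv (deriv F) z / deriv F z)) := by
    have h1 : conj z * z = ((‖z‖ ^ 2 : ℝ) : ℂ) := by
      rw [← normSq_eq_conj_mul_self, normSq_eq_norm_sq]
    have h2 : ((-(‖z‖ ^ 2 / 2) : ℝ) : ℂ) = -(conj z * z) / 2 := by
      rw [h1]; push_cast; ring
    rw [h2]
    have := hne z hzb
    field_simp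
  rw [e3, re_ofReal_mul] at hle
  have hz2 : 0 < ‖z‖ ^ 2 := by have := norm_pos_iff.2 hz0; positivity
  nlinarith

/-- The Carathéodory bound for functions with nonnegative real part. -/
theorem le_re_of_re_nonneg {p : ℂ → ℂ} (hp : DifferentiableOn ℂ p (ball 0 1))
    (hpos : ∀ z ∈ ball (0 : ℂ) 1, 0 ≤ (p z).re) (h0 : p 0 = 1) {z : ℂ} (hz : ‖z‖ < 1) :
    (1 - ‖z‖) / (1 + ‖z‖) ≤ (p z).re := by
  have hne : ∀ w ∈ ball (0 : ℂ) 1, 1 + p w ≠ 0 := by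
    intro w hw h
    have := congrArg re h
    have h1 := hpos w hw
    simp at this
    linarith
  have hle : ‖(1 - p z) / (1 + p z)‖ ≤ ‖z‖ := by
    refine norm_le_norm_of_mapsTo_ball (R := 1) (f := fun w => (1 - p w) / (1 + p w))
      ((hp.const_sub 1).div (hp.const_add 1) hne) ?_ (by simp [h0]) hz
    intro w hw
    rw [mem_closedBall_zero_iff, norm_div, div_le_one (norm_pos_iff.2 (hne w hw))]
    apply le_of_sq_le_sq _ (norm_nonneg _)
    rw [← normSq_eq_norm_sq, ← normSq_eq_norm_sq, normSq_apply, normSq_apply]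
    have := hpos w hw
    simp
    nlinarith
  have hzb : z ∈ ball (0 : ℂ) 1 := by simpa using hz
  rw [norm_div, div_le_iff₀ (norm_pos_iff.2 (hne z hzb))] at hle
  have hz0 := norm_nonneg z
  have h1 : 1 - ‖z‖ ≤ (1 + ‖z‖) * ‖p z‖ := by
    have h2 := norm_sub_norm_le (1 : ℂ) (p z)
    have h3 := norm_add_le (1 : ℂ) (p z)
    rw [norm_one] at h2 h3
    nlinarith
  have hsq := pow_le_pow_left₀ (norm_nonneg _) hle 2
  rw [mul_pow, ← normSq_eq_norm_sq (1 - p z), ← normSq_eq_norm_sq (1 + p z), normSq_apply,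
    normSq_apply] at hsq
  simp only [sub_re, sub_im, add_re, add_im, one_re, one_im] at hsq
  rw [div_le_iff₀ (by positivity)]
  set x := (p z).re
  set y := (p z).im
  set r := ‖z‖
  have hx : 0 ≤ x := hpos z hzb
  -- This is |1 - p| ≤ r|1 + p| squared, with y² dropped. The difference of its two sides factors as
  -- (1 - r - x(1 + r))(1 + r - x(1 - r)), and both factors would be positive if x < (1 - r)/(1 +
  -- r).
  have h5 : (1 + x * x) * (1 - r ^ 2) ≤ 2 * x * (1 + r ^ 2) := by
    nlinarith [mul_nonneg (mul_self_nonneg y) (by nlinarith : (0:ℝ) ≤ 1 - r ^ 2)]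
  by_contra hcon
  push Not at hcon
  have h6 : 0 < (1 - r - x * (1 + r)) * ((1 + r) - x * (1 - r)) := by
    apply mul_pos (by linarith)
    nlinarith
  nlinarith

/-! ### The area theorem -/

/-- The open annulus `ε < |z| < r`. -/
def annulus (ε r : ℝ) : Set ℂ := {z | ε < ‖z‖ ∧ ‖z‖ < r}

theorem isOpen_annulus (ε r : ℝ) : IsOpen (annulus ε r) :=
  (isOpen_lt continuous_const continuous_norm).inter (isOpen_lt continuous_norm continuous_const)

/-- The closed annulus `ε ≤ |z| ≤ r`. -/
def closedAnnulus (ε r : ℝ) : Set ℂ := {z | ε ≤ ‖z‖ ∧ ‖z‖ ≤ r}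

theorem isCompact_closedAnnulus (ε r : ℝ) : IsCompact (closedAnnulus ε r) := by
  have h : closedAnnulus ε r = closedBall 0 r ∩ {z | ε ≤ ‖z‖} := by
    ext z
    simp [closedAnnulus, and_comm]
  rw [h]
  exact (isCompact_closedBall 0 r).inter_right (isClosed_le continuous_const continuous_norm)

theorem annulus_subset_closedAnnulus (ε r : ℝ) : annulus ε r ⊆ closedAnnulus ε r :=
  fun _ hz => ⟨hz.1.le, hz.2.le⟩

theorem integrableOn_annulus {H : ℂ → ℝ} {ε r : ℝ} (hH : ContinuousOn H (closedAnnulus ε r)) :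
    IntegrableOn H (annulus ε r) :=
  (hH.integrableOn_compact (isCompact_closedAnnulus ε r)).mono_set
    (annulus_subset_closedAnnulus ε r)

/-- A lower bound for the circle averages gives a lower bound for the integral over an annulus. -/
theorem le_integral_annulus {H : ℂ → ℝ} {B : ℝ → ℝ} {ε r : ℝ} (hε : 0 < ε) (hεr : ε < r)
    (hH : ContinuousOn H (closedAnnulus ε r)) (hB : ContinuousOn B (Icc ε r))
    (hle : ∀ s ∈ Ioo ε r, B s ≤ Real.circleAverage H 0 s) :
    2 * Real.pi * ∫ s in ε..r, s * B s ≤ ∫ z in annulus ε r, H z := by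
  have hpolar : ∫ z in annulus ε r, H z =
      ∫ p in Ioo ε r ×ˢ Ioo (-Real.pi) Real.pi, p.1 * H (Complex.polarCoord.symm p) := by
    rw [← integral_indicator (isOpen_annulus ε r).measurableSet,
      ← Complex.integral_comp_polarCoord_symm, ← integral_indicator
        polarCoord.open_target.measurableSet, ← integral_indicator
        (measurableSet_Ioo.prod measurableSet_Ioo)]
    congr 1
    ext p
    by_cases hp : p ∈ polarCoord.target
    · rw [indicator_of_mem hp]
      have hp1 : 0 < p.1 := hp.1
      have hp2 : p.2 ∈ Ioo (-Real.pi) Real.pi := hp.2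
      by_cases hq : p ∈ Ioo ε r ×ˢ Ioo (-Real.pi) Real.pi
      · rw [indicator_of_mem hq, indicator_of_mem, smul_eq_mul]
        rw [annulus, mem_ofPred_eq, norm_polarCoord_symm, abs_of_pos hp1]
        exact hq.1
      · rw [indicator_of_notMem hq, indicator_of_notMem, smul_zero]
        rw [annulus, mem_ofPred_eq, norm_polarCoord_symm, abs_of_pos hp1]
        exact fun h => hq ⟨h, hp2⟩
    · rw [indicator_of_notMem hp, indicator_of_notMem]
      exact fun h => hp ⟨hε.trans h.1.1, h.2⟩
  have hcont : ContinuousOn (fun p : ℝ × ℝ => p.1 * H (Complex.polarCoord.symm p))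
      (Icc ε r ×ˢ Icc (-Real.pi) Real.pi) := by
    refine continuousOn_fst.mul (hH.comp ?_ ?_)
    · have : (fun p : ℝ × ℝ => Complex.polarCoord.symm p) =
          fun p => (p.1 : ℂ) * (Real.cos p.2 + Real.sin p.2 * I) := by
        ext p
        rw [Complex.polarCoord_symm_apply]
      change ContinuousOn (fun p : ℝ × ℝ => Complex.polarCoord.symm p) _
      rw [this]
      fun_prop
    · intro p hp
      rw [closedAnnulus, mem_ofPred_eq, norm_polarCoord_symm, abs_of_pos (hε.trans_le hp.1.1)]
      exact hp.1
  have hint : IntegrableOn (fun p : ℝ × ℝ => p.1 * H (Complex.polarCoord.symm p))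
      (Ioo ε r ×ˢ Ioo (-Real.pi) Real.pi) :=
    (hcont.integrableOn_compact (isCompact_Icc.prod isCompact_Icc)).mono_set
      (prod_mono Ioo_subset_Icc_self Ioo_subset_Icc_self)
  have hinner : ∀ s : ℝ, ∫ θ in Ioo (-Real.pi) Real.pi, s * H (Complex.polarCoord.symm (s, θ)) =
      s * (2 * Real.pi * Real.circleAverage H 0 s) := by
    intro s
    rw [integral_const_mul, ← integral_Ioc_eq_integral_Ioo,
      ← intervalIntegral.integral_of_le (by linarith [Real.pi_pos]),
      Real.circleAverage_eq_integral_add (-Real.pi),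
      intervalIntegral.integral_comp_add_right (fun θ => H (circleMap 0 s θ)), smul_eq_mul,
      mul_inv_cancel_left₀ Real.two_pi_pos.ne']
    congr 1
    have e1 : 0 + -Real.pi = -Real.pi := by ring
    have e2 : 2 * Real.pi + -Real.pi = Real.pi := by ring
    rw [e1, e2]
    refine intervalIntegral.integral_congr fun θ _ => ?_
    simp only [Complex.polarCoord_symm_apply, circleMap, zero_add]
    rw [exp_mul_I]
    simp
  rw [hpolar, Measure.volume_eq_prod, setIntegral_prod _ (by
    rw [← Measure.volume_eq_prod]; exact hint)]
  simp only [hinner]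
  rw [intervalIntegral.integral_of_le hεr.le, integral_Ioc_eq_integral_Ioo, ← integral_const_mul]
  refine setIntegral_mono_on ?_ ?_ measurableSet_Ioo ?_
  · have : ContinuousOn (fun s => 2 * Real.pi * (s * B s)) (Icc ε r) :=
      continuousOn_const.mul (continuousOn_id.mul hB)
    exact (this.integrableOn_compact isCompact_Icc).mono_set Ioo_subset_Icc_self
  · have h1 : Integrable (fun p : ℝ × ℝ => p.1 * H (Complex.polarCoord.symm p))
        ((volume.restrict (Ioo ε r)).prod (volume.restrict (Ioo (-Real.pi) Real.pi))) := by
      rw [Measure.prod_restrict, ← Measure.volume_eq_prod]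
      exact hint
    have h2 := h1.integral_prod_left
    simp only [hinner] at h2
    exact h2
  · intro s hs
    have hs0 : 0 < s := hε.trans hs.1
    have h1 := mul_le_mul_of_nonneg_left (hle s hs) (by positivity : 0 ≤ 2 * Real.pi * s)
    calc 2 * Real.pi * (s * B s) = 2 * Real.pi * s * B s := by ring
      _ ≤ 2 * Real.pi * s * Real.circleAverage H 0 s := h1
      _ = _ := by ring

theorem circleAverage_re_eq {q : ℂ → ℂ} {s : ℝ} (hq : DifferentiableOn ℂ q (ball 0 1))
    (hs : 0 < s) (hs1 : s < 1) : Real.circleAverage (fun z => (q z).re) 0 s = (q 0).re := by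
  have hsub : closedBall (0 : ℂ) s ⊆ ball 0 1 := closedBall_subset_ball hs1
  have hc : DiffContOnCl ℂ q (ball 0 |s|) := by
    rw [abs_of_pos hs]
    exact (hq.mono hsub).diffContOnCl_ball subset_rfl
  have hci : CircleIntegrable q 0 s := ContinuousOn.circleIntegrable hs.le
    (hq.continuousOn.mono (sphere_subset_closedBall.trans hsub))
  have := reCLM.circleAverage_comp_comm hci
  rw [hc.circleAverage] at this
  exact this

/-- Lower bound for the circle averages of the integrand in the proof of the area theorem. -/
theorem le_circleAverage_of_analytic {p q : ℂ → ℂ} {s M δ : ℝ}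
    (hp : DifferentiableOn ℂ p (ball 0 1)) (hq : DifferentiableOn ℂ q (ball 0 1))
    (hs : 0 < s) (hs1 : s < 1) (hδ : 0 ≤ δ) (hM : ∀ z : ℂ, ‖z‖ = s → ‖q z‖ ≤ M) :
    (s ^ 4)⁻¹ + ‖p 0‖ ^ 2 - δ * ((s ^ 6)⁻¹ + M ^ 2) ≤
      Real.circleAverage (fun z => ‖-(z ^ 2)⁻¹ + p z‖ ^ 2 - δ * ‖-(z ^ 3)⁻¹ + q z‖ ^ 2) 0 s := by
  -- On |z| = s the cross terms of the squares are real parts of analytic functions, because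
  -- conj(z⁻ⁿ) = zⁿ/s²ⁿ. Replacing |p|² by its minorant 2Re(conj p(0) p) - |p(0)|² and |q|² by M²
  -- leaves Re Q, whose circle average is Re Q(0).
  set Q : ℂ → ℂ := fun z => (((s ^ 4)⁻¹ : ℝ) : ℂ) - ((2 * (s ^ 4)⁻¹ : ℝ) : ℂ) * (z ^ 2 * p z) +
    (2 * conj (p 0) * p z - ((‖p 0‖ ^ 2 : ℝ) : ℂ)) -
    (δ : ℂ) * ((((s ^ 6)⁻¹ : ℝ) : ℂ) - ((2 * (s ^ 6)⁻¹ : ℝ) : ℂ) * (z ^ 3 * q z) +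
    ((M ^ 2 : ℝ) : ℂ)) with hQ
  have hQd : DifferentiableOn ℂ Q (ball 0 1) := by
    simp only [hQ]
    fun_prop
  have hQ0 : (Q 0).re = (s ^ 4)⁻¹ + ‖p 0‖ ^ 2 - δ * ((s ^ 6)⁻¹ + M ^ 2) := by
    have : Q 0 = (((s ^ 4)⁻¹ + ‖p 0‖ ^ 2 - δ * ((s ^ 6)⁻¹ + M ^ 2) : ℝ) : ℂ) := by
      have h1 : conj (p 0) * p 0 = ((‖p 0‖ ^ 2 : ℝ) : ℂ) := by
        rw [← normSq_eq_conj_mul_self, normSq_eq_norm_sq]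
      simp only [hQ]
      rw [mul_assoc 2, h1]
      push_cast
      ring
    rw [this, ofReal_re]
  rw [← hQ0, ← circleAverage_re_eq hQd hs hs1]
  have hsub : sphere (0 : ℂ) s ⊆ ball 0 1 := fun z hz => by
    rw [mem_sphere_zero_iff_norm] at hz
    rw [mem_ball_zero_iff, hz]
    exact hs1
  have hne : ∀ z ∈ sphere (0 : ℂ) s, z ≠ 0 := fun z hz h => by
    rw [mem_sphere_zero_iff_norm, h, norm_zero] at hz
    exact hs.ne hz
  have hnorm : ∀ (n : ℕ) (z m : ℂ), z ≠ 0 → ‖z‖ = s →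
      ‖-(z ^ n)⁻¹ + m‖ ^ 2 = (s ^ (2 * n))⁻¹ - 2 * (s ^ (2 * n))⁻¹ * (z ^ n * m).re + ‖m‖ ^ 2 := by
    intro n z m hz hzs
    have h1 : (z ^ n)⁻¹ = (((s ^ (2 * n))⁻¹ : ℝ) : ℂ) * conj (z ^ n) := by
      rw [inv_def, normSq_eq_norm_sq, norm_pow, hzs, mul_comm, ← pow_mul, mul_comm n]
    have h2 : ‖(z ^ n)⁻¹‖ ^ 2 = (s ^ (2 * n))⁻¹ := by
      rw [norm_inv, norm_pow, hzs, inv_pow, ← pow_mul, mul_comm n]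
    have h3 : ‖-(z ^ n)⁻¹ + m‖ ^ 2 =
        ‖(z ^ n)⁻¹‖ ^ 2 - 2 * (conj (z ^ n)⁻¹ * m).re + ‖m‖ ^ 2 := by
      rw [← normSq_eq_norm_sq, ← normSq_eq_norm_sq, ← normSq_eq_norm_sq]
      generalize (z ^ n)⁻¹ = w
      simp only [normSq_apply, add_re, add_im, neg_re, neg_im, mul_re, conj_re, conj_im]
      ring
    rw [h3, h2, h1, map_mul, conj_ofReal, conj_conj, mul_assoc, re_ofReal_mul]
    ring
  refine Real.circleAverage_mono ?_ ?_ ?_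
  · exact ContinuousOn.circleIntegrable hs.le
      (continuous_re.comp_continuousOn (hQd.continuousOn.mono hsub))
  · have hpc := hp.continuousOn.mono hsub
    have hqc := hq.continuousOn.mono hsub
    have hinv : ∀ n : ℕ, ContinuousOn (fun z : ℂ => (z ^ n)⁻¹) (sphere 0 s) := fun n =>
      (continuousOn_id.pow n).inv₀ fun z hz => pow_ne_zero n (hne z hz)
    exact ContinuousOn.circleIntegrable hs.le
      ((((hinv 2).neg.add hpc).norm.pow 2).sub
        (continuousOn_const.mul (((hinv 3).neg.add hqc).norm.pow 2)))
  · intro z hz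
    rw [abs_of_pos hs] at hz
    have hz0 := hne z hz
    have hzs : ‖z‖ = s := by simpa using hz
    have e2 := hnorm 2 z (p z) hz0 hzs
    have e3 := hnorm 3 z (q z) hz0 hzs
    rw [show 2 * 2 = 4 from rfl] at e2
    rw [show 2 * 3 = 6 from rfl] at e3
    rw [e2, e3]
    have h1 : 0 ≤ ‖p z - p 0‖ ^ 2 := by positivity
    have h2 : ‖p z - p 0‖ ^ 2 = ‖p z‖ ^ 2 - 2 * (conj (p 0) * p z).re + ‖p 0‖ ^ 2 := by
      rw [← normSq_eq_norm_sq, ← normSq_eq_norm_sq, ← normSq_eq_norm_sq]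
      simp only [normSq_apply, sub_re, sub_im, mul_re, conj_re, conj_im]
      ring
    have h3 : ‖q z‖ ^ 2 ≤ M ^ 2 := pow_le_pow_left₀ (norm_nonneg _) (hM z hzs) 2
    have h4 := mul_le_mul_of_nonneg_left h3 hδ
    have h5 : (2 * conj (p 0) * p z).re = 2 * (conj (p 0) * p z).re := by
      rw [mul_assoc]
      simp
    simp only [hQ, sub_re, add_re, re_ofReal_mul, ofReal_re, h5]
    linarith

/-- This weight truncates the plane at radius 1/ε. It permits comparing areas by a change of
variables on an annulus, without computing the area enclosed by the image of a circle. -/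
theorem integrable_hat {ε : ℝ} (hε : 0 < ε) :
    Integrable fun w : ℂ => max 0 (1 - ε ^ 2 * ‖w‖ ^ 2) := by
  have hc : Continuous fun w : ℂ => max 0 (1 - ε ^ 2 * ‖w‖ ^ 2) := by fun_prop
  refine hc.integrable_of_hasCompactSupport ?_
  refine HasCompactSupport.of_support_subset_isCompact (isCompact_closedBall (0 : ℂ) ε⁻¹) ?_
  intro w hw
  rw [mem_closedBall_zero_iff]
  by_contra h
  push Not at h
  apply hw
  have h1 : 1 < ε * ‖w‖ := by rwa [inv_lt_iff_one_lt_mul₀ hε, mul_comm] at h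
  exact max_eq_left (by nlinarith)

theorem integral_hat {ε : ℝ} (hε : 0 < ε) :
    ∫ w : ℂ, max 0 (1 - ε ^ 2 * ‖w‖ ^ 2) = Real.pi / (2 * ε ^ 2) := by
  rw [integral_fun_norm_addHaar volume (fun y : ℝ => max 0 (1 - ε ^ 2 * y ^ 2)),
    Complex.finrank_real_complex]
  have hvol : volume.real (ball (0 : ℂ) 1) = Real.pi := by
    simp [Measure.real, Complex.volume_ball]
  have hint : ∫ y in Ioi (0 : ℝ), y ^ (2 - 1) • max 0 (1 - ε ^ 2 * y ^ 2) = 1 / (4 * ε ^ 2) := by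
    have h1 : ∫ y in Ioi (0 : ℝ), y ^ (2 - 1) • max 0 (1 - ε ^ 2 * y ^ 2) =
        ∫ y in Ioc (0 : ℝ) ε⁻¹, y ^ (2 - 1) • max 0 (1 - ε ^ 2 * y ^ 2) := by
      refine (setIntegral_eq_of_subset_of_forall_sdiff_eq_zero measurableSet_Ioi
        Ioc_subset_Ioi_self ?_)
      rintro y ⟨hy0, hy⟩
      have hy1 : ε⁻¹ < y := by
        by_contra h
        exact hy ⟨hy0, not_lt.1 h⟩
      have h1 : 1 < ε * y := by rwa [inv_lt_iff_one_lt_mul₀ hε, mul_comm] at hy1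
      rw [max_eq_left (by nlinarith), smul_zero]
    have h2 : ∫ y in Ioc (0 : ℝ) ε⁻¹, y ^ (2 - 1) • max 0 (1 - ε ^ 2 * y ^ 2) =
        ∫ y in Ioc (0 : ℝ) ε⁻¹, (y - ε ^ 2 * y ^ 3) := by
      refine setIntegral_congr_fun measurableSet_Ioc fun y hy => ?_
      have h1 : ε * y ≤ 1 := by
        have := mul_le_mul_of_nonneg_left hy.2 hε.le
        rwa [mul_inv_cancel₀ hε.ne'] at this
      have h3 : 0 ≤ ε * y := mul_nonneg hε.le hy.1.le
      have h4 : max 0 (1 - ε ^ 2 * y ^ 2) = 1 - ε ^ 2 * y ^ 2 := max_eq_right (by nlinarith)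
      simp only [h4, smul_eq_mul]
      ring
    rw [h1, h2, ← intervalIntegral.integral_of_le (inv_nonneg.2 hε.le)]
    have h3 : ∀ y ∈ uIcc 0 ε⁻¹, HasDerivAt (fun y : ℝ => y ^ 2 / 2 - ε ^ 2 * (y ^ 4 / 4))
        (y - ε ^ 2 * y ^ 3) y := by
      intro y _
      have := ((hasDerivAt_pow 2 y).div_const 2).sub
        (((hasDerivAt_pow 4 y).div_const 4).const_mul (ε ^ 2))
      convert! this using 1
      norm_num
    rw [intervalIntegral.integral_eq_sub_of_hasDerivAt h3
      (Continuous.intervalIntegrable (by fun_prop) _ _)]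
    field_simp
    norm_num
  rw [hint, hvol]
  simp only [nsmul_eq_mul, smul_eq_mul]
  field_simp
  norm_num

/-- After multiplication by 2π, the singular term (ε²)⁻¹/2 contributes exactly the integral π/(2ε²)
of the weight. The two cancel, leaving an inequality with a limit as ε → 0. -/
theorem integral_radial_bound {ε r c M : ℝ} (hε : 0 < ε) (hεr : ε < r) :
    ∫ s in ε..r, s * ((s ^ 4)⁻¹ + c - ε ^ 2 * ((s ^ 6)⁻¹ + M)) =
      (c * (r ^ 2 - ε ^ 2) - (r ^ 2)⁻¹ + ε ^ 2 * (r ^ 4)⁻¹ / 2 - ε ^ 2 * M * (r ^ 2 - ε ^ 2) +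
        (ε ^ 2)⁻¹ / 2) / 2 := by
  have hpos : ∀ s ∈ uIcc ε r, 0 < s := by
    intro s hs
    rw [uIcc_of_le hεr.le] at hs
    exact hε.trans_le hs.1
  have hd : ∀ s ∈ uIcc ε r, HasDerivAt
      (fun s : ℝ => -(s ^ 2)⁻¹ / 2 + c * (s ^ 2 / 2) -
        ε ^ 2 * (-(s ^ 4)⁻¹ / 4 + M * (s ^ 2 / 2)))
      (s * ((s ^ 4)⁻¹ + c - ε ^ 2 * ((s ^ 6)⁻¹ + M))) s := by
    intro s hs
    have hs0 := (hpos s hs).ne'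
    have h2 := hasDerivAt_pow 2 s
    have h4 := hasDerivAt_pow 4 s
    have := (((h2.inv (pow_ne_zero 2 hs0)).neg.div_const 2).add
      ((h2.div_const 2).const_mul c)).sub
      ((((h4.inv (pow_ne_zero 4 hs0)).neg.div_const 4).add
      ((h2.div_const 2).const_mul M)).const_mul (ε ^ 2))
    convert! this using 1
    norm_num
    field_simp
  rw [intervalIntegral.integral_eq_sub_of_hasDerivAt hd]
  · have : r ≠ 0 := (hε.trans hεr).ne'
    field_simp
    ring
  · refine ContinuousOn.intervalIntegrable ?_
    have h4 : ContinuousOn (fun s : ℝ => (s ^ 4)⁻¹) (uIcc ε r) :=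
      (continuousOn_id.pow 4).inv₀ fun s hs => pow_ne_zero 4 (hpos s hs).ne'
    have h6 : ContinuousOn (fun s : ℝ => (s ^ 6)⁻¹) (uIcc ε r) :=
      (continuousOn_id.pow 6).inv₀ fun s hs => pow_ne_zero 6 (hpos s hs).ne'
    exact continuousOn_id.mul ((h4.add continuousOn_const).sub
      (continuousOn_const.mul (h6.add continuousOn_const)))

/-- The real Jacobian of multiplication by F' is |F'|². -/
theorem integral_image_eq_integral_norm_deriv_sq {F F' : ℂ → ℂ} {A : Set ℂ} (hA : MeasurableSet A)
    (hF : ∀ z ∈ A, HasDerivAt F (F' z) z) (hinj : InjOn F A) (W : ℂ → ℝ) :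
    ∫ w in F '' A, W w = ∫ z in A, ‖F' z‖ ^ 2 * W (F z) := by
  rw [integral_image_eq_integral_abs_det_fderiv_smul volume hA
    (fun z hz => ((hF z hz).hasFDerivAt.restrictScalars ℝ).hasFDerivWithinAt) hinj W]
  refine setIntegral_congr_fun hA fun z _ => ?_
  simp [ContinuousLinearMap.det, LinearMap.det_restrictScalars,
    Algebra.norm_complex_eq, Complex.normSq_eq_norm_sq]

/-- The **area theorem**, for the first coefficient. -/
theorem norm_le_one_of_injOn_inv_add {κ : ℂ → ℂ} (hκ : DifferentiableOn ℂ κ (ball 0 1))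
    (hinj : InjOn (fun z => z⁻¹ + z * κ z) (ball 0 1 \ {0})) : ‖κ 0‖ ≤ 1 := by
  -- For F = 1/z + zκ, these are the regular parts in F' = -z⁻² + p and FF' = -z⁻³ + q.
  set p : ℂ → ℂ := fun z => κ z + z * deriv κ z with hp
  set q : ℂ → ℂ := fun z => deriv κ z + z * κ z * p z with hq
  have hκ' := hκ.deriv isOpen_ball
  have hpd : DifferentiableOn ℂ p (ball 0 1) := hκ.add (differentiableOn_id.mul hκ')
  have hqd : DifferentiableOn ℂ q (ball 0 1) := hκ'.add ((differentiableOn_id.mul hκ).mul hpd)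
  have hp0 : p 0 = κ 0 := by simp [hp]
  set F : ℂ → ℂ := fun z => z⁻¹ + z * κ z with hF
  have hFd : ∀ z ∈ ball (0 : ℂ) 1, z ≠ 0 → HasDerivAt F (-(z ^ 2)⁻¹ + p z) z := by
    intro z hz hz0
    have h1 := (hasDerivAt_inv hz0).add
      ((hasDerivAt_id z).mul (hκ.differentiableAt (isOpen_ball.mem_nhds hz)).hasDerivAt)
    convert! h1 using 1
    simp [hp]
  have hFF : ∀ z : ℂ, z ≠ 0 → (-(z ^ 2)⁻¹ + p z) * F z = -(z ^ 3)⁻¹ + q z := by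
    intro z hz0
    simp only [hF, hq, hp]
    field_simp
    ring
  have hmain : ∀ r : ℝ, 0 < r → r < 1 → ‖κ 0‖ ^ 2 * r ^ 2 ≤ (r ^ 2)⁻¹ := by
    intro r hr hr1
    have hcb : closedBall (0 : ℂ) r ⊆ ball 0 1 := closedBall_subset_ball hr1
    obtain ⟨M, hM⟩ := (isCompact_closedBall (0 : ℂ) r).exists_bound_of_continuousOn
      (hqd.continuousOn.mono hcb)
    have hineq : ∀ ε : ℝ, 0 < ε → ε < r →
        ‖κ 0‖ ^ 2 * (r ^ 2 - ε ^ 2) ≤ (r ^ 2)⁻¹ + ε ^ 2 * M ^ 2 * (r ^ 2 - ε ^ 2) := by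
      intro ε hε hεr
      have hAne : ∀ z ∈ closedAnnulus ε r, z ≠ 0 := by
        rintro z hz rfl
        have := hz.1
        rw [norm_zero] at this
        linarith
      have hAsub : closedAnnulus ε r ⊆ ball 0 1 := fun z hz => hcb (by simpa using hz.2)
      have hA := annulus_subset_closedAnnulus ε r
      set H : ℂ → ℝ := fun z => ‖-(z ^ 2)⁻¹ + p z‖ ^ 2 - ε ^ 2 * ‖-(z ^ 3)⁻¹ + q z‖ ^ 2 with hH
      have hinv : ∀ n : ℕ, ContinuousOn (fun z : ℂ => (z ^ n)⁻¹) (closedAnnulus ε r) := fun n =>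
        (continuousOn_id.pow n).inv₀ fun z hz => pow_ne_zero n (hAne z hz)
      have hF'c : ContinuousOn (fun z => -(z ^ 2)⁻¹ + p z) (closedAnnulus ε r) :=
        (hinv 2).neg.add (hpd.continuousOn.mono hAsub)
      have hFc : ContinuousOn F (closedAnnulus ε r) := fun z hz =>
        (hFd z (hAsub hz) (hAne z hz)).continuousAt.continuousWithinAt
      have hHc : ContinuousOn H (closedAnnulus ε r) := (hF'c.norm.pow 2).sub
        (continuousOn_const.mul (((hinv 3).neg.add (hqd.continuousOn.mono hAsub)).norm.pow 2))
      set W : ℂ → ℝ := fun w => max 0 (1 - ε ^ 2 * ‖w‖ ^ 2) with hW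
      have hWc : Continuous W := by fun_prop
      have h1 : 2 * Real.pi * ∫ s in ε..r, s * ((s ^ 4)⁻¹ + ‖κ 0‖ ^ 2 -
          ε ^ 2 * ((s ^ 6)⁻¹ + M ^ 2)) ≤ ∫ z in annulus ε r, H z := by
        refine le_integral_annulus hε hεr hHc ?_ ?_
        · have hne : ∀ s ∈ Icc ε r, s ≠ 0 := fun s hs => (hε.trans_le hs.1).ne'
          have h4 : ContinuousOn (fun s : ℝ => (s ^ 4)⁻¹) (Icc ε r) :=
            (continuousOn_id.pow 4).inv₀ fun s hs => pow_ne_zero 4 (hne s hs)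
          have h6 : ContinuousOn (fun s : ℝ => (s ^ 6)⁻¹) (Icc ε r) :=
            (continuousOn_id.pow 6).inv₀ fun s hs => pow_ne_zero 6 (hne s hs)
          exact (h4.add continuousOn_const).sub
            (continuousOn_const.mul (h6.add continuousOn_const))
        · intro s hs
          rw [← hp0]
          refine le_circleAverage_of_analytic hpd hqd (hε.trans hs.1) (hs.2.trans hr1)
            (by positivity) fun z hz => hM z ?_
          rw [mem_closedBall_zero_iff, hz]
          exact hs.2.le
      -- H = |F'|²(1 - ε²|F|²) is at most |F'|² W(F), and injectivity of F bounds the integral of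
      -- the latter by the integral of W over the plane.
      have h2 : ∫ z in annulus ε r, H z ≤
          ∫ z in annulus ε r, ‖-(z ^ 2)⁻¹ + p z‖ ^ 2 * W (F z) := by
        refine setIntegral_mono_on (integrableOn_annulus hHc) (integrableOn_annulus
          ((hF'c.norm.pow 2).mul (hWc.comp_continuousOn hFc)))
          (isOpen_annulus ε r).measurableSet fun z hz => ?_
        have e1 : H z = ‖-(z ^ 2)⁻¹ + p z‖ ^ 2 * (1 - ε ^ 2 * ‖F z‖ ^ 2) := by
          simp only [hH]
          rw [← hFF z (hAne z (hA hz)), norm_mul]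
          ring
        rw [e1]
        exact mul_le_mul_of_nonneg_left (le_max_right _ _) (by positivity)
      have hinjA : InjOn F (annulus ε r) :=
        hinj.mono fun z hz => mem_sdiff_singleton.2 ⟨hAsub (hA hz), hAne z (hA hz)⟩
      have h3 : ∫ z in annulus ε r, ‖-(z ^ 2)⁻¹ + p z‖ ^ 2 * W (F z) ≤ ∫ w, W w := by
        rw [← integral_image_eq_integral_norm_deriv_sq (isOpen_annulus ε r).measurableSet
          (fun z hz => hFd z (hAsub (hA hz)) (hAne z (hA hz)))
          hinjA]
        exact setIntegral_le_integral (integrable_hat hε)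
          (Eventually.of_forall fun w => le_max_left _ _)
      have h4 := h1.trans (h2.trans h3)
      rw [integral_hat hε, integral_radial_bound hε hεr] at h4
      have h5 : Real.pi / (2 * ε ^ 2) = Real.pi * ((ε ^ 2)⁻¹ / 2) := by
        field_simp
      rw [h5, mul_comm 2 Real.pi, mul_assoc] at h4
      have h6 := le_of_mul_le_mul_left h4 Real.pi_pos
      have h7 : 0 ≤ ε ^ 2 * (r ^ 4)⁻¹ / 2 := by positivity
      linarith
    have hev : ∀ᶠ ε : ℝ in 𝓝[>] 0, ‖κ 0‖ ^ 2 * (r ^ 2 - ε ^ 2) ≤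
        (r ^ 2)⁻¹ + ε ^ 2 * M ^ 2 * (r ^ 2 - ε ^ 2) := by
      filter_upwards [Ioo_mem_nhdsGT hr] with ε hε using hineq ε hε.1 hε.2
    have t1 : Tendsto (fun ε : ℝ => ‖κ 0‖ ^ 2 * (r ^ 2 - ε ^ 2)) (𝓝[>] 0)
        (𝓝 (‖κ 0‖ ^ 2 * (r ^ 2 - 0 ^ 2))) :=
      (Continuous.tendsto (by fun_prop) 0).mono_left nhdsWithin_le_nhds
    have t2 : Tendsto (fun ε : ℝ => (r ^ 2)⁻¹ + ε ^ 2 * M ^ 2 * (r ^ 2 - ε ^ 2)) (𝓝[>] 0)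
        (𝓝 ((r ^ 2)⁻¹ + 0 ^ 2 * M ^ 2 * (r ^ 2 - 0 ^ 2))) :=
      (Continuous.tendsto (by fun_prop) 0).mono_left nhdsWithin_le_nhds
    simpa using le_of_tendsto_of_tendsto t1 t2 hev
  have hev : ∀ᶠ r : ℝ in 𝓝[<] 1, ‖κ 0‖ ^ 2 * r ^ 2 * r ^ 2 ≤ 1 := by
    filter_upwards [Ioo_mem_nhdsLT (zero_lt_one' ℝ)] with r hr
    have h1 := hmain r hr.1 hr.2
    have h2 : 0 < r ^ 2 := pow_pos hr.1 2
    calc ‖κ 0‖ ^ 2 * r ^ 2 * r ^ 2 ≤ (r ^ 2)⁻¹ * r ^ 2 := mul_le_mul_of_nonneg_right h1 h2.le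
      _ = 1 := inv_mul_cancel₀ h2.ne'
  have t1 : Tendsto (fun r : ℝ => ‖κ 0‖ ^ 2 * r ^ 2 * r ^ 2) (𝓝[<] 1)
      (𝓝 (‖κ 0‖ ^ 2 * 1 ^ 2 * 1 ^ 2)) :=
    (Continuous.tendsto (by fun_prop) 1).mono_left nhdsWithin_le_nhds
  have h := le_of_tendsto t1 hev
  simp only [one_pow, mul_one] at h
  exact (sq_le_one_iff₀ (norm_nonneg _)).1 h

/-! ### Bieberbach's theorem and the Koebe transform -/

/-- **Bieberbach's theorem** on the second coefficient of a univalent function. -/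
theorem norm_deriv_deriv_le_four {G : ℂ → ℂ} (hG : G ∈ classS) : ‖deriv (deriv G) 0‖ ≤ 4 := by
  obtain ⟨⟨hGd, hG0, hG1⟩, hinj⟩ := hG
  have h0 : (0 : ℂ) ∈ ball (0 : ℂ) 1 := by simp
  have hGa : AnalyticAt ℂ G 0 := hGd.analyticAt (isOpen_ball.mem_nhds h0)
  set D := dslope G 0 with hD
  have hDd : DifferentiableOn ℂ D (ball 0 1) :=
    (differentiableOn_dslope (isOpen_ball.mem_nhds h0)).2 hGd
  have hGD : ∀ z, G z = z * D z := fun z => by rw [eq_add_mul_dslope G z, hG0, zero_add]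
  have hD0 : D 0 = 1 := by rw [hD, dslope_same, hG1]
  have hDne : ∀ z ∈ ball (0 : ℂ) 1, D z ≠ 0 := by
    intro z hz h
    rcases eq_or_ne z 0 with rfl | hz0
    · rw [hD0] at h
      exact one_ne_zero h
    · apply hz0
      apply hinj hz h0
      rw [hGD z, h, hG0, mul_zero]
  obtain ⟨L, hL0, hL⟩ := exists_log_on_ball one_pos hDd hDne
  rw [hD0, log_one] at hL0
  -- E is (G(z)/z)^{-1/2}, so E(z²)/z is the reciprocal of the square-root transform of G. It equals
  -- 1/z + zK(z²) with K(0) = -G''(0)/4, and the area theorem applies.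
  set E : ℂ → ℂ := fun z => exp (-L z / 2) with hE
  have hEd : ∀ z ∈ ball (0 : ℂ) 1, HasDerivAt E (E z * (-(deriv D z / D z) / 2)) z := fun z hz =>
    ((hL z hz).2.neg.div_const 2).cexp
  have hED : DifferentiableOn ℂ E (ball 0 1) := fun z hz =>
    (hEd z hz).differentiableAt.differentiableWithinAt
  have hE0 : E 0 = 1 := by simp [hE, hL0]
  have hE2 : ∀ z ∈ ball (0 : ℂ) 1, E z ^ 2 * D z = 1 := by
    intro z hz
    rw [← (hL z hz).1, hE, ← exp_nat_mul, ← exp_add]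
    convert exp_zero using 2
    push_cast
    ring
  set K := dslope E 0 with hK
  have hKd : DifferentiableOn ℂ K (ball 0 1) :=
    (differentiableOn_dslope (isOpen_ball.mem_nhds h0)).2 hED
  have hEK : ∀ z, E z = 1 + z * K z := fun z => by rw [eq_add_mul_dslope E z, hE0]
  have hsq : ∀ z ∈ ball (0 : ℂ) 1, z ^ 2 ∈ ball (0 : ℂ) 1 := by
    intro z hz
    rw [mem_ball_zero_iff] at hz ⊢
    rw [norm_pow]
    exact pow_lt_one₀ (norm_nonneg _) hz two_ne_zero
  have hF : ∀ z : ℂ, z ≠ 0 → z⁻¹ + z * K (z ^ 2) = E (z ^ 2) / z := by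
    intro z hz
    rw [hEK]
    field_simp
  have hκ := norm_le_one_of_injOn_inv_add (κ := fun z => K (z ^ 2))
    (hKd.comp (by fun_prop) hsq) (by
      rintro z ⟨hz, hz0⟩ w ⟨hw, hw0⟩ h
      have hz0 : z ≠ 0 := hz0
      have hw0 : w ≠ 0 := hw0
      simp only [hF z hz0, hF w hw0] at h
      have h1 : ∀ z ∈ ball (0 : ℂ) 1, z ≠ 0 → (E (z ^ 2) / z) ^ 2 * G (z ^ 2) = 1 := by
        intro z hz hz0
        rw [hGD, div_pow, ← hE2 _ (hsq z hz)]
        field_simp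
      have h2 : G (z ^ 2) = G (w ^ 2) := by
        have e1 := h1 z hz hz0
        have e2 := h1 w hw hw0
        rw [← h, ← e1] at e2
        refine (mul_left_cancel₀ ?_ e2).symm
        intro h0'
        rw [h0', zero_mul] at e1
        exact zero_ne_one e1
      -- Oddness of E(z²)/z excludes z = -w, since the common value would be its own negative, while
      -- it never vanishes.
      rcases sq_eq_sq_iff_eq_or_eq_neg.1 (hinj (hsq z hz) (hsq w hw) h2) with h3 | h3
      · exact h3
      · exfalso
        rw [h3, neg_sq, div_neg] at h
        have h4 : E (w ^ 2) / w = 0 := by linear_combination (-1 / 2 : ℂ) * h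
        exact div_ne_zero (exp_ne_zero _) hw0 h4)
  have hK0 : K (0 ^ 2) = -deriv (deriv G) 0 / 4 := by
    rw [zero_pow two_ne_zero, hK, dslope_same, (hEd 0 h0).deriv, hE0, hD0,
      deriv_deriv_eq_two_mul_deriv_dslope hGa]
    ring
  rw [hK0, norm_div, norm_neg] at hκ
  norm_num at hκ
  linarith

/-- The distortion bound for univalent functions obtained from the Koebe transform. -/
theorem le_re_of_mem_classS {G : ℂ → ℂ} (hG : G ∈ classS) {a : ℂ} (ha : ‖a‖ < 1)
    (hne : deriv G a ≠ 0) :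
    (1 - 4 * ‖a‖ + ‖a‖ ^ 2) / (1 - ‖a‖ ^ 2) ≤
      (1 + a * (deriv (deriv G) a / deriv G a)).re := by
  obtain ⟨⟨hGd, hG0, hG1⟩, hinj⟩ := hG
  have hU : IsOpen unitDisk := isOpen_ball
  have h0 : (0 : ℂ) ∈ unitDisk := by simp [unitDisk]
  have ha' : a ∈ unitDisk := by simpa [unitDisk] using ha
  have hap : 0 < 1 - ‖a‖ ^ 2 := sub_pos.2 (pow_lt_one₀ (norm_nonneg _) ha two_ne_zero)
  set A : ℂ := 1 - conj a * a with hA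
  have hAr : A = ((1 - ‖a‖ ^ 2 : ℝ) : ℂ) := by
    rw [hA, ← normSq_eq_conj_mul_self, normSq_eq_norm_sq]; push_cast; ring
  have hA0 : A ≠ 0 := by rw [hAr]; exact ofReal_ne_zero.2 hap.ne'
  -- The Koebe transform of G at a is again in 𝒮, and its second derivative at 0 is (1 -
  -- |a|²)G''(a)/G'(a) - 2 conj a. Multiplying by a and using the bound 4 gives the estimate.
  set G₁ : ℂ → ℂ := fun ζ => (G (diskShift a ζ) - G a) / (A * deriv G a) with hG₁
  have hT : ∀ ζ ∈ unitDisk, diskShift a ζ ∈ unitDisk := fun ζ hζ => by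
    simpa [unitDisk] using norm_diskShift_lt ha (by simpa [unitDisk] using hζ)
  have hTd : ∀ ζ ∈ unitDisk, HasDerivAt (diskShift a) (A / (1 + conj a * ζ) ^ 2) ζ := fun ζ hζ =>
    hasDerivAt_diskShift ha (by simpa [unitDisk] using hζ)
  have hG₁d : ∀ ζ ∈ unitDisk, HasDerivAt G₁
      (deriv G (diskShift a ζ) * (A / (1 + conj a * ζ) ^ 2) / (A * deriv G a)) ζ := fun ζ hζ =>
    (((hGd.differentiableAt (hU.mem_nhds (hT ζ hζ))).hasDerivAt.comp ζ
      (hTd ζ hζ)).sub_const (G a)).div_const _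
  have hmem : G₁ ∈ classS := by
    refine ⟨⟨fun ζ hζ => (hG₁d ζ hζ).differentiableAt.differentiableWithinAt, ?_, ?_⟩, ?_⟩
    · simp [hG₁]
    · rw [(hG₁d 0 h0).deriv, diskShift_zero]
      field_simp
      simp
    · intro z hz w hw h
      simp only [hG₁] at h
      rw [div_left_inj' (mul_ne_zero hA0 hne), sub_left_inj] at h
      exact diskShift_injOn ha hz hw (hinj (hT z hz) (hT w hw) h)
  have hsec : deriv (deriv G₁) 0 = A * (deriv (deriv G) a / deriv G a) - 2 * conj a := by
    have he : deriv G₁ =ᶠ[𝓝 0] fun ζ =>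
        deriv G (diskShift a ζ) * (A / (1 + conj a * ζ) ^ 2) / (A * deriv G a) := by
      filter_upwards [hU.mem_nhds h0] with ζ hζ using (hG₁d ζ hζ).deriv
    rw [he.deriv_eq]
    have h1 : HasDerivAt (deriv G) (deriv (deriv G) a) (diskShift a 0) := by
      rw [diskShift_zero]
      exact ((hGd.deriv hU).differentiableAt (hU.mem_nhds ha')).hasDerivAt
    have h2 : HasDerivAt (fun ζ : ℂ => 1 + conj a * ζ) (conj a * 1) 0 :=
      ((hasDerivAt_id (0 : ℂ)).const_mul (conj a)).const_add 1
    have h3 := (hasDerivAt_const (0 : ℂ) A).div (h2.pow 2) (by simp)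
    have h4 := ((h1.comp 0 (hTd 0 h0)).mul h3).div_const (A * deriv G a)
    have h5 : deriv (fun ζ =>
        deriv G (diskShift a ζ) * (A / (1 + conj a * ζ) ^ 2) / (A * deriv G a)) 0 = _ := h4.deriv
    rw [h5]
    simp only [Function.comp_apply, diskShift_zero, mul_zero, add_zero, one_pow, div_one, mul_one,
      Pi.pow_apply, Pi.div_apply]
    field_simp
    push_cast
    ring
  have hle := norm_deriv_deriv_le_four hmem
  rw [hsec] at hle
  have h1 : ‖a * (A * (deriv (deriv G) a / deriv G a) - 2 * conj a)‖ ≤ ‖a‖ * 4 := by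
    rw [norm_mul]
    exact mul_le_mul_of_nonneg_left hle (norm_nonneg _)
  have h2 := neg_le_of_abs_le ((abs_re_le_norm _).trans h1)
  have h3 : a * (A * (deriv (deriv G) a / deriv G a) - 2 * conj a) =
      ((1 - ‖a‖ ^ 2 : ℝ) : ℂ) * (a * (deriv (deriv G) a / deriv G a)) -
        ((2 * ‖a‖ ^ 2 : ℝ) : ℂ) := by
    have h4 : conj a * a = ((‖a‖ ^ 2 : ℝ) : ℂ) := by
      rw [← normSq_eq_conj_mul_self, normSq_eq_norm_sq]
    rw [← hAr, ofReal_mul, ← h4]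
    push_cast
    ring
  rw [h3, sub_re, re_ofReal_mul, ofReal_re] at h2
  rw [add_re, one_re, div_le_iff₀ hap]
  linarith

/-! ### Lower bounds for Re(1 + zG''/G') in each class -/

theorem classSStar_subset_classS : classSStar ⊆ classS := fun _ h => h.1

/-- With s = |z|, the inequality (1 - 4s + s²)/(1 - s²) > s/(1 - s) reduces to 1 - 5s > 0. -/
theorem lt_re_of_mem_classS {G : ℂ → ℂ} (hG : G ∈ classS) (hne : ∀ z ∈ unitDisk, deriv G z ≠ 0)
    {z : ℂ} (hz : ‖z‖ < 1 / 5) :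
    ‖z‖ / (1 - ‖z‖) < (1 + z * (deriv (deriv G) z / deriv G z)).re := by
  have hz1 : ‖z‖ < 1 := hz.trans (by norm_num)
  refine lt_of_lt_of_le ?_ (le_re_of_mem_classS hG hz1 (hne z (by simpa [unitDisk] using hz1)))
  have h0 := norm_nonneg z
  rw [div_lt_div_iff₀ (by linarith) (by nlinarith)]
  nlinarith

/-- Convexity of G makes 1 + zG''/G' a function with nonnegative real part, and (1 - s)/(1 + s) >
s/(1 - s) reduces to 1 - 3s > 0. -/
theorem lt_re_of_mem_classK {G : ℂ → ℂ} (hG : G ∈ classK) (hne : ∀ z ∈ unitDisk, deriv G z ≠ 0)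
    {z : ℂ} (hz : ‖z‖ < 1 / 3) :
    ‖z‖ / (1 - ‖z‖) < (1 + z * (deriv (deriv G) z / deriv G z)).re := by
  obtain ⟨⟨⟨hGd, -, -⟩, hinj⟩, hconv⟩ := hG
  have hz1 : ‖z‖ < 1 := hz.trans (by norm_num)
  have hG' : DifferentiableOn ℂ (deriv G) (ball 0 1) := hGd.deriv isOpen_ball
  have hp : DifferentiableOn ℂ (fun z => 1 + z * (deriv (deriv G) z / deriv G z)) (ball 0 1) :=
    (differentiableOn_id.mul ((hG'.deriv isOpen_ball).div hG' hne)).const_add 1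
  refine lt_of_lt_of_le ?_ (le_re_of_re_nonneg hp
    (fun w hw => re_nonneg_of_convexInDisk hGd hne ⟨hinj, hconv⟩ (by simpa using hw))
    (by simp) hz1)
  have h0 := norm_nonneg z
  rw [div_lt_div_iff₀ (by linarith) (by linarith)]
  nlinarith

/-- The logarithmic derivative of a function with positive real part. -/
theorem norm_deriv_mul_le_of_re_pos {p : ℂ → ℂ} (hp : DifferentiableOn ℂ p (ball 0 1))
    (hpos : ∀ z ∈ ball (0 : ℂ) 1, 0 < (p z).re) {z : ℂ} (hz : ‖z‖ < 1) :
    ‖deriv p z‖ * (1 - ‖z‖ ^ 2) ≤ 2 * (p z).re := by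
  have hzb : z ∈ ball (0 : ℂ) 1 := by simpa using hz
  have hne : ∀ w ∈ ball (0 : ℂ) 1, p w + 1 ≠ 0 := by
    intro w hw h
    have := congrArg re h
    have h1 := hpos w hw
    simp at this
    linarith
  have hsq : ∀ w : ℂ, ‖w + 1‖ ^ 2 - ‖w - 1‖ ^ 2 = 4 * w.re := by
    intro w
    rw [← normSq_eq_norm_sq, ← normSq_eq_norm_sq]
    simp only [normSq_apply, add_re, add_im, sub_re, sub_im, one_re, one_im]
    ring
  have hd : ∀ w ∈ ball (0 : ℂ) 1,
      HasDerivAt (fun w => (p w - 1) / (p w + 1)) (2 * deriv p w / (p w + 1) ^ 2) w := by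
    intro w hw
    have h1 := (hp.differentiableAt (isOpen_ball.mem_nhds hw)).hasDerivAt
    convert! (h1.sub_const 1).div (h1.add_const 1) (hne w hw) using 1
    ring
  -- Schwarz–Pick for the Cayley transform (p - 1)/(p + 1), whose modulus deficit is governed by |p
  -- + 1|² - |p - 1|² = 4 Re p.
  have h := norm_deriv_mul_le_of_norm_le (ω := fun w => (p w - 1) / (p w + 1))
    (fun w hw => (hd w hw).differentiableAt.differentiableWithinAt) (fun w hw => by
      rw [norm_div, div_le_one (norm_pos_iff.2 (hne w hw))]
      apply le_of_sq_le_sq _ (norm_nonneg _)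
      linarith [hsq (p w), hpos w hw]) hz
  have hpz : 0 < ‖p z + 1‖ ^ 2 := pow_pos (norm_pos_iff.2 (hne z hzb)) 2
  rw [(hd z hzb).deriv, norm_div, norm_div, norm_mul, norm_pow, div_pow, norm_ofNat,
    div_mul_eq_mul_div, div_le_iff₀ hpz, sub_mul, div_mul_cancel₀ _ hpz.ne'] at h
  linarith [hsq (p z)]

/-- Here |zG''/G'| ≤ 2s/(1 - s²), and the comparison becomes 1 - 3s - 2s² > 0, whose positive root
is (√17 - 3)/4. -/
theorem lt_re_of_mem_classR {G : ℂ → ℂ} (hG : G ∈ classR) {z : ℂ}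
    (hz : ‖z‖ < (Real.sqrt 17 - 3) / 4) :
    ‖z‖ / (1 - ‖z‖) < (1 + z * (deriv (deriv G) z / deriv G z)).re := by
  obtain ⟨⟨hGd, -, -⟩, hpos⟩ := hG
  have h17 : Real.sqrt 17 ^ 2 = 17 := Real.sq_sqrt (by norm_num)
  have h17n : 0 ≤ Real.sqrt 17 := Real.sqrt_nonneg 17
  have h0 := norm_nonneg z
  have hquad : 0 < 1 - 3 * ‖z‖ - 2 * ‖z‖ ^ 2 := by nlinarith
  have hz1 : ‖z‖ < 1 := by nlinarith
  have hzb : z ∈ unitDisk := by simpa [unitDisk] using hz1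
  have h1 := norm_deriv_mul_le_of_re_pos (hGd.deriv isOpen_ball) hpos hz1
  have hG0 : 0 < ‖deriv G z‖ := (hpos z hzb).trans_le (re_le_norm _)
  have hs : 0 < 1 - ‖z‖ ^ 2 := by nlinarith
  have h2 : ‖z * (deriv (deriv G) z / deriv G z)‖ ≤ 2 * ‖z‖ / (1 - ‖z‖ ^ 2) := by
    rw [norm_mul, norm_div, le_div_iff₀ hs, ← mul_div_assoc, div_mul_eq_mul_div,
      div_le_iff₀ hG0]
    have h3 := mul_le_mul_of_nonneg_left (h1.trans
      (mul_le_mul_of_nonneg_left (re_le_norm (deriv G z)) zero_le_two)) h0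
    linarith
  have h3 := neg_le_of_abs_le ((abs_re_le_norm _).trans h2)
  rw [add_re, one_re]
  have h4 : ‖z‖ / (1 - ‖z‖) < 1 - 2 * ‖z‖ / (1 - ‖z‖ ^ 2) := by
    rw [one_sub_div hs.ne', div_lt_div_iff₀ (by linarith) hs]
    nlinarith
  linarith

/-- The estimate behind the radius of convexity for derivatives with real part above `1/2`. -/
theorem lt_re_one_add_div_one_sub {w X : ℂ} {s : ℝ} (hs0 : 0 ≤ s) (hs : s < 1) (hw : ‖w‖ ≤ s)
    (hX : ‖X - w‖ * (1 - s ^ 2) ≤ s ^ 2 - ‖w‖ ^ 2) (hpoly : (2 + s + s ^ 2) ^ 2 < 8 * (1 - s ^ 2)) :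
    s / (1 - s) < (1 + X / (1 - w)).re := by
  set t := ‖1 - w‖ with ht
  have hts : 1 - s ≤ t := by
    have := norm_sub_norm_le (1 : ℂ) w
    rw [norm_one] at this
    linarith
  have ht0 : 0 < t := by linarith
  have hu : (1 - w : ℂ) ≠ 0 := norm_pos_iff.1 ht0
  have hs2 : 0 < 1 - s ^ 2 := by nlinarith
  set y := (1 - w).re with hy
  have hyt : y ≤ t := re_le_norm _
  have hnw : ‖w‖ ^ 2 = 1 - 2 * y + t ^ 2 := by
    rw [ht, hy, ← normSq_eq_norm_sq, ← normSq_eq_norm_sq]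
    simp only [normSq_apply, sub_re, sub_im, one_re, one_im]
    ring
  have e : 1 + X / (1 - w) = (1 - w)⁻¹ + (X - w) / (1 - w) := by
    field_simp
    ring
  have e1 : ((1 - w)⁻¹).re = y / t ^ 2 := by rw [inv_re, normSq_eq_norm_sq]
  have e2 : ‖(X - w) / (1 - w)‖ ≤ (s ^ 2 - ‖w‖ ^ 2) / ((1 - s ^ 2) * t) := by
    rw [norm_div, div_le_div_iff₀ ht0 (mul_pos hs2 ht0)]
    have := mul_le_mul_of_nonneg_right hX ht0.le
    linarith
  have e3 := neg_le_of_abs_le ((abs_re_le_norm _).trans e2)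
  rw [e, add_re, e1]
  -- After |w|² = 1 - 2y + t² is inserted, the difference of the sides is affine in y with
  -- coefficient 1 - s² - 2t ≤ 0, so y = t is the worst case. What remains is t times a quadratic in
  -- t of discriminant (2 + s + s²)² - 8(1 - s²) = s⁴ + 2s³ + 13s² + 4s - 4, negative by `hpoly`.
  have key : s * (1 + s) * t ^ 2 < y * (1 - s ^ 2) - t * (s ^ 2 - ‖w‖ ^ 2) := by
    rw [hnw]
    have h1 : 0 ≤ (t - y) * (2 * t - (1 - s ^ 2)) :=
      mul_nonneg (by linarith) (by nlinarith)
    have h2 : 0 < t * (2 * (1 - s ^ 2) + t ^ 2 - (2 + s + s ^ 2) * t) := by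
      refine mul_pos ht0 ?_
      nlinarith [sq_nonneg (t - (2 + s + s ^ 2) / 2)]
    nlinarith
  have h4 : s / (1 - s) < y / t ^ 2 - (s ^ 2 - ‖w‖ ^ 2) / ((1 - s ^ 2) * t) := by
    have e5 : s / (1 - s) = (s * (1 + s) * t ^ 2) / ((1 - s ^ 2) * t ^ 2) := by
      have h5 : 1 - s ≠ 0 := by linarith
      rw [div_eq_div_iff h5 (by positivity)]
      ring
    have e6 : y / t ^ 2 - (s ^ 2 - ‖w‖ ^ 2) / ((1 - s ^ 2) * t) =
        (y * (1 - s ^ 2) - t * (s ^ 2 - ‖w‖ ^ 2)) / ((1 - s ^ 2) * t ^ 2) := by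
      have := hs2.ne'
      field_simp
    rw [e5, e6]
    exact div_lt_div_of_pos_right key (by positivity)
  linarith

/-- Re G' > 1/2 means |G' - 1| < |G'|, so W = 1 - 1/G' maps the disk into itself and fixes 0. With W
= zb one has zG''/G' = zW'/(1 - W) and zW' - W = z²b'. Schwarz–Pick for b, which may be a unimodular
constant, provides the hypothesis of `lt_re_one_add_div_one_sub` with X = zW'. -/
theorem lt_re_of_mem_classRHalf {G : ℂ → ℂ} (hG : G ∈ classRHalf) {z : ℂ} (hz : ‖z‖ < 1)
    (hpoly : (2 + ‖z‖ + ‖z‖ ^ 2) ^ 2 < 8 * (1 - ‖z‖ ^ 2)) :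
    ‖z‖ / (1 - ‖z‖) < (1 + z * (deriv (deriv G) z / deriv G z)).re := by
  obtain ⟨⟨hGd, -, hG1⟩, hpos⟩ := hG
  have h0 : (0 : ℂ) ∈ ball (0 : ℂ) 1 := by simp
  have hzb : z ∈ ball (0 : ℂ) 1 := by simpa using hz
  have hG' : DifferentiableOn ℂ (deriv G) (ball 0 1) := hGd.deriv isOpen_ball
  have hne : ∀ w ∈ ball (0 : ℂ) 1, deriv G w ≠ 0 := by
    intro w hw h
    have := hpos w hw
    rw [h, zero_re] at this
    linarith
  set W : ℂ → ℂ := fun w => 1 - (deriv G w)⁻¹ with hW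
  have hWd : DifferentiableOn ℂ W (ball 0 1) := (hG'.inv hne).const_sub 1
  have hW0 : W 0 = 0 := by simp [hW, hG1]
  have hWb : ∀ w ∈ ball (0 : ℂ) 1, ‖W w‖ ≤ 1 := by
    intro w hw
    have h1 : W w = (deriv G w - 1) / deriv G w := by
      simp only [hW]
      field_simp [hne w hw]
    rw [h1, norm_div, div_le_one (norm_pos_iff.2 (hne w hw))]
    apply le_of_sq_le_sq _ (norm_nonneg _)
    rw [← normSq_eq_norm_sq, ← normSq_eq_norm_sq]
    simp only [normSq_apply, sub_re, sub_im, one_re, one_im]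
    linarith [hpos w hw]
  set b := dslope W 0 with hb
  have hbd : DifferentiableOn ℂ b (ball 0 1) :=
    (differentiableOn_dslope (isOpen_ball.mem_nhds h0)).2 hWd
  have hbb : ∀ w ∈ ball (0 : ℂ) 1, ‖b w‖ ≤ 1 := fun w hw => by
    simpa using norm_dslope_le_div_of_mapsTo_ball (R₂ := 1) hWd
      (fun v hv => by rw [hW0]; simpa using hWb v hv) hw
  have hWe : ∀ w, W w = w * b w := fun w => by rw [eq_add_mul_dslope W w, hW0, zero_add]
  have hW' : HasDerivAt W (b z + z * deriv b z) z := by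
    have h1 := (hasDerivAt_id z).mul (hbd.differentiableAt (isOpen_ball.mem_nhds hzb)).hasDerivAt
    have h2 : W = fun w => w * b w := funext hWe
    rw [h2]
    convert! h1 using 1
    simp
  have hW'' : HasDerivAt W (deriv (deriv G) z / deriv G z ^ 2) z := by
    have h1 := ((hG'.differentiableAt (isOpen_ball.mem_nhds hzb)).hasDerivAt.inv
      (hne z hzb)).const_sub 1
    convert! h1 using 1
    ring
  have heq := hW'.unique hW''
  have hWz : 1 - W z = (deriv G z)⁻¹ := by simp [hW]
  have e : z * (deriv (deriv G) z / deriv G z) = z * (b z + z * deriv b z) / (1 - W z) := by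
    rw [heq, hWz]
    have := hne z hzb
    field_simp
  rw [e]
  refine lt_re_one_add_div_one_sub (norm_nonneg z) hz
    (norm_le_norm_of_mapsTo_ball hWd (fun v hv => by simpa using hWb v hv) hW0 hz) ?_ hpoly
  have h1 := norm_deriv_mul_le_of_norm_le hbd hbb hz
  have h2 : z * (b z + z * deriv b z) - W z = z ^ 2 * deriv b z := by
    rw [hWe]
    ring
  rw [h2, hWe, norm_mul, norm_mul, norm_pow]
  have h3 := mul_le_mul_of_nonneg_left h1 (sq_nonneg ‖z‖)
  nlinarith

/-! ### The sharpness criterion -/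

/-- A holomorphic function on the unit disk with value `1` at the origin is the derivative of a
member of the class `𝒜`. -/
theorem exists_mem_classA_deriv_eq {P : ℂ → ℂ} (hP : DifferentiableOn ℂ P unitDisk)
    (hP0 : P 0 = 1) : ∃ G ∈ classA, ∀ z ∈ unitDisk, deriv G z = P z := by
  obtain ⟨G, hG0, hG⟩ := hP.isExactOn_ball.with_val_at 0 0
  have h0 : (0 : ℂ) ∈ unitDisk := by simp [unitDisk]
  exact ⟨G, ⟨fun z hz => (hG z hz).differentiableAt.differentiableWithinAt, hG0,
    by rw [(hG 0 h0).deriv, hP0]⟩, fun z hz => (hG z hz).deriv⟩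

/-- With h = f and g = 0 the defining inequality reads |z| < 1. -/
theorem mem_classFH_of_deriv_eq {G f : ℂ → ℂ}
    (hne : ∀ z ∈ unitDisk, deriv G z ≠ 0) (hf : f ∈ classA)
    (hf' : ∀ z ∈ unitDisk, deriv f z = deriv G z * (1 + z)) : f ∈ classFH G := by
  obtain ⟨hfd, hf0, hf1⟩ := hf
  have h0 : (0 : ℂ) ∈ unitDisk := by simp [unitDisk]
  have hU : IsOpen unitDisk := isOpen_ball
  refine ⟨⟨fun z hz => (hfd.analyticAt (hU.mem_nhds hz)).harmonicAt, hf0, ?_⟩, f, 0,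
    ⟨hfd, differentiableOn_const 0, hf0, rfl, by simp⟩, ?_⟩
  · rw [((hfd.differentiableAt (hU.mem_nhds h0)).hasFDerivAt.restrictScalars ℝ).fderiv]
    ext v
    simp [fderiv_eq_smul_deriv, hf1]
  · intro z hz
    rw [hf' z hz, mul_div_cancel_left₀ _ (hne z hz)]
    have : deriv (0 : ℂ → ℂ) z = 0 := by simp
    rw [this]
    simpa [unitDisk] using hz

/-- Criterion for the sharp radius of convexity; the extremal function has derivative
`G' (1 + z)`. -/
theorem isSharpRadiusFor_of {𝓖 : Set (ℂ → ℂ)} {r : ℝ} (hr0 : 0 < r) (hr1 : r < 1)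
    (h𝓖 : 𝓖 ⊆ classA)
    (hpos : ∀ G ∈ 𝓖, (∀ z ∈ unitDisk, deriv G z ≠ 0) → ∀ z : ℂ, ‖z‖ < r →
      ‖z‖ / (1 - ‖z‖) < (1 + z * (deriv (deriv G) z / deriv G z)).re)
    {G P : ℂ → ℂ} (hG : G ∈ 𝓖) (hGP : ∀ z ∈ unitDisk, deriv G z = P z)
    (hP : ∀ z ∈ unitDisk, P z ≠ 0)
    (hneg : ∀ x : ℝ, r < x → x < 1 → ∃ l : ℝ, HasDerivAt P (P (-x : ℝ) * l) ((-x : ℝ) : ℂ) ∧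
      1 - x * (l + 1 / (1 - x)) < 0) :
    IsSharpRadiusFor 𝓖 r := by
  have hconv : ∀ f ∈ ⋃ G ∈ 𝓖, classFH G, ∀ ρ : ℝ, 0 < ρ → ρ ≤ r → ConvexInDisk f ρ := by
    intro f hf ρ _ hρr
    simp only [mem_iUnion] at hf
    obtain ⟨G', hG', hf⟩ := hf
    exact convexInDisk_of_mem_classFH (h𝓖 hG') hf (hρr.trans hr1.le) fun hne z hz =>
      hpos G' hG' hne z ((by simpa using hz : ‖z‖ < ρ).trans_le hρr)
  have hU : IsOpen unitDisk := isOpen_ball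
  have hGne : ∀ z ∈ unitDisk, deriv G z ≠ 0 := fun z hz => by rw [hGP z hz]; exact hP z hz
  obtain ⟨hGd, hG0, hG1⟩ := h𝓖 hG
  obtain ⟨f, hfA, hf'⟩ := exists_mem_classA_deriv_eq (P := fun z => deriv G z * (1 + z))
    ((hGd.deriv hU).mul (by fun_prop)) (by simp [hG1])
  have hfFH : f ∈ classFH G := mem_classFH_of_deriv_eq hGne hfA hf'
  have hfne : ∀ z ∈ unitDisk, deriv f z ≠ 0 := by
    intro z hz
    rw [hf' z hz]
    refine mul_ne_zero (hGne z hz) fun h => ?_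
    have hz' : ‖z‖ < 1 := by simpa [unitDisk] using hz
    rw [eq_neg_of_add_eq_zero_right h, norm_neg, norm_one] at hz'
    exact lt_irrefl _ hz'
  have hnc : ∀ ρ : ℝ, r < ρ → ρ ≤ 1 → ¬ ConvexInDisk f ρ := by
    intro ρ hρ hρ1 hcon
    -- Any x strictly between r and ρ would do: at -x, with l the logarithmic derivative of P there,
    -- 1 + zf''/f' is the negative number supplied by `hneg`.
    set x := (r + ρ) / 2 with hx
    have hx1 : r < x := by rw [hx]; linarith
    have hx2 : x < ρ := by rw [hx]; linarith
    have hx3 : x < 1 := hx2.trans_le hρ1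
    obtain ⟨l, hl, hlneg⟩ := hneg x hx1 hx3
    have hsub : ball (0 : ℂ) ρ ⊆ unitDisk := ball_subset_ball hρ1
    have hnx : ‖((-x : ℝ) : ℂ)‖ = x := by
      rw [norm_real, norm_neg, Real.norm_of_nonneg (by linarith)]
    have hzU : ((-x : ℝ) : ℂ) ∈ unitDisk := by
      rw [unitDisk, mem_ball_zero_iff, hnx]
      exact hx3
    have h := re_nonneg_of_convexInDisk (hfA.1.mono hsub) (fun z hz => hfne z (hsub hz)) hcon
      (z := ((-x : ℝ) : ℂ)) (by rw [hnx]; exact hx2)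
    have hd : deriv (deriv f) ((-x : ℝ) : ℂ) =
        P (-x : ℝ) * l * (1 + ((-x : ℝ) : ℂ)) + P (-x : ℝ) := by
      have he : deriv f =ᶠ[𝓝 ((-x : ℝ) : ℂ)] fun z => P z * (1 + z) := by
        filter_upwards [hU.mem_nhds hzU] with z hz
        rw [hf' z hz, hGP z hz]
      rw [he.deriv_eq]
      have h1 := hl.mul ((hasDerivAt_id ((-x : ℝ) : ℂ)).const_add 1)
      have h2 : deriv (fun z => P z * (1 + z)) ((-x : ℝ) : ℂ) = _ := h1.deriv
      rw [h2]
      simp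
    have hPx := hP _ hzU
    have h1x : (1 + ((-x : ℝ) : ℂ)) ≠ 0 := by
      have : 1 + -x ≠ 0 := by linarith
      exact_mod_cast this
    have e : 1 + ((-x : ℝ) : ℂ) * (deriv (deriv f) ((-x : ℝ) : ℂ) / deriv f ((-x : ℝ) : ℂ)) =
        ((1 - x * (l + 1 / (1 - x)) : ℝ) : ℂ) := by
      have e1 : ((1 - x * (l + 1 / (1 - x)) : ℝ) : ℂ) =
          1 + ((-x : ℝ) : ℂ) * (l + 1 / (1 + ((-x : ℝ) : ℂ))) := by
        push_cast
        ring
      rw [hd, hf' _ hzU, hGP _ hzU, e1]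
      field_simp
    rw [e, ofReal_re] at h
    linarith
  refine ⟨⟨⟨hr0, hr1.le, hconv⟩, ?_⟩, G, hG, f, hfFH, hnc⟩
  rintro ρ ⟨hρ0, hρ1, hρ⟩
  by_contra hlt
  push Not at hlt
  exact hnc ρ hlt hρ1 (hρ f (mem_biUnion hG hfFH) ρ hρ0 le_rfl)

/-! ### Extremal functions for 𝒮, 𝒮*, 𝒦 and ℛ -/

theorem one_sub_ne_zero_of_mem {z : ℂ} (hz : z ∈ unitDisk) : 1 - z ≠ 0 := by
  intro h
  have hz' : ‖z‖ < 1 := by simpa [unitDisk] using hz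
  rw [← sub_eq_zero.1 h, norm_one] at hz'
  exact lt_irrefl _ hz'

theorem one_add_ne_zero_of_mem {z : ℂ} (hz : z ∈ unitDisk) : 1 + z ≠ 0 := by
  have := one_sub_ne_zero_of_mem (z := -z) (by simpa [unitDisk] using hz)
  rwa [sub_neg_eq_add] at this

theorem normSq_lt_one_of_mem {z : ℂ} (hz : z ∈ unitDisk) : z.re * z.re + z.im * z.im < 1 := by
  have hz' : ‖z‖ < 1 := by simpa [unitDisk] using hz
  rw [← normSq_apply, normSq_eq_norm_sq]
  exact pow_lt_one₀ (norm_nonneg _) hz' two_ne_zero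

theorem re_div_pos_iff {a b : ℂ} (hb : b ≠ 0) :
    0 < (a / b).re ↔ 0 < a.re * b.re + a.im * b.im := by
  rw [div_re, ← add_div]
  exact div_pos_iff_of_pos_right (normSq_pos.2 hb)

theorem re_one_add_div_one_sub_pos {z : ℂ} (hz : z ∈ unitDisk) : 0 < ((1 + z) / (1 - z)).re := by
  rw [re_div_pos_iff (one_sub_ne_zero_of_mem hz)]
  simp only [add_re, add_im, sub_re, sub_im, one_re, one_im]
  linarith [normSq_lt_one_of_mem hz]

theorem exists_eq_one_add_div_one_sub {v : ℂ} (hv : 0 < v.re) :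
    ∃ z ∈ unitDisk, (1 + z) / (1 - z) = v := by
  have hne : v + 1 ≠ 0 := by
    intro h
    have := congrArg re h
    simp at this
    linarith
  refine ⟨(v - 1) / (v + 1), ?_, ?_⟩
  · rw [unitDisk, mem_ball_zero_iff, norm_div, div_lt_one (norm_pos_iff.2 hne)]
    apply lt_of_pow_lt_pow_left₀ 2 (norm_nonneg _)
    rw [← normSq_eq_norm_sq, ← normSq_eq_norm_sq]
    simp only [normSq_apply, add_re, add_im, sub_re, sub_im, one_re, one_im]
    linarith
  · have h1 : 1 + (v - 1) / (v + 1) = 2 * v / (v + 1) := by field_simp; ring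
    have h2 : 1 - (v - 1) / (v + 1) = 2 / (v + 1) := by field_simp; ring
    rw [h1, h2]
    field_simp

/-- The Koebe function. -/
noncomputable def koebe (z : ℂ) : ℂ := z / (1 - z) ^ 2

theorem hasDerivAt_koebe {z : ℂ} (hz : 1 - z ≠ 0) :
    HasDerivAt koebe ((1 + z) / (1 - z) ^ 3) z := by
  have h := (hasDerivAt_id z).div (((hasDerivAt_id z).const_sub 1).pow 2) (pow_ne_zero 2 hz)
  convert! h using 1
  simp only [id, Pi.pow_apply]
  field_simp
  push_cast
  ring

/-- The Koebe function is, up to an affine map, the square of a conformal map onto the right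
half-plane; hence its image is a slit plane. -/
theorem one_add_four_mul_koebe {z : ℂ} (hz : 1 - z ≠ 0) :
    1 + 4 * koebe z = ((1 + z) / (1 - z)) ^ 2 := by
  rw [koebe]
  field_simp
  ring

theorem koebe_image : koebe '' unitDisk = {w | 1 + 4 * w ∈ slitPlane} := by
  ext w
  constructor
  · rintro ⟨z, hz, rfl⟩
    change 1 + 4 * koebe z ∈ slitPlane
    rw [one_add_four_mul_koebe (one_sub_ne_zero_of_mem hz)]
    have hv := re_one_add_div_one_sub_pos hz
    generalize (1 + z) / (1 - z) = v at hv ⊢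
    rw [mem_slitPlane_iff, pow_two, mul_re, mul_im]
    by_cases h : v.im = 0
    · left
      rw [h]
      nlinarith
    · right
      have := mul_ne_zero hv.ne' h
      intro h'
      apply this
      linarith
  · intro hw
    obtain ⟨v, hv, hre⟩ : ∃ v : ℂ, v ^ 2 = 1 + 4 * w ∧ 0 < v.re := by
      obtain ⟨v, hv⟩ := IsAlgClosed.exists_pow_nat_eq (1 + 4 * w) two_pos
      rcases lt_trichotomy v.re 0 with h | h | h
      · exact ⟨-v, by rw [neg_sq, hv], by simpa using h⟩
      · exfalso
        change 1 + 4 * w ∈ slitPlane at hw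
        rw [← hv, mem_slitPlane_iff, pow_two, mul_re, mul_im, h] at hw
        rcases hw with h' | h'
        · nlinarith [mul_self_nonneg v.im]
        · simp at h'
      · exact ⟨v, hv, h⟩
    obtain ⟨z, hz, rfl⟩ := exists_eq_one_add_div_one_sub hre
    refine ⟨z, hz, ?_⟩
    rw [← one_add_four_mul_koebe (one_sub_ne_zero_of_mem hz)] at hv
    linear_combination hv / 4

theorem koebe_mem_classSStar : koebe ∈ classSStar := by
  have h0 : (0 : ℂ) ∈ unitDisk := by simp [unitDisk]
  refine ⟨⟨⟨fun z hz => (hasDerivAt_koebe (one_sub_ne_zero_of_mem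
    hz)).differentiableAt.differentiableWithinAt, by simp [koebe], ?_⟩, ?_⟩, ?_⟩
  · rw [(hasDerivAt_koebe (one_sub_ne_zero_of_mem h0)).deriv]
    simp
  · intro z hz w hw h
    have hz1 := one_sub_ne_zero_of_mem hz
    have hw1 := one_sub_ne_zero_of_mem hw
    rw [koebe, koebe, div_eq_div_iff (pow_ne_zero 2 hz1) (pow_ne_zero 2 hw1)] at h
    have h1 : (z - w) * (1 - z * w) = 0 := by linear_combination h
    refine sub_eq_zero.1 ((mul_eq_zero.1 h1).resolve_right (one_sub_ne_zero_of_mem ?_))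
    have hz' : ‖z‖ < 1 := by simpa [unitDisk] using hz
    have hw' : ‖w‖ < 1 := by simpa [unitDisk] using hw
    rw [unitDisk, mem_ball_zero_iff, norm_mul]
    exact mul_lt_one_of_nonneg_of_lt_one_left (norm_nonneg _) hz' hw'.le
  · rw [koebe_image]
    intro w hw a b ha hb hab
    -- The affine map w ↦ 1 + 4w carries 0 to 1, so starlikeness about 0 becomes that of the slit
    -- plane about 1.
    have h := starConvex_one_slitPlane hw ha hb hab
    change 1 + 4 * (a • (0 : ℂ) + b • w) ∈ slitPlane
    convert h using 1
    have : (a : ℂ) + b = 1 := by exact_mod_cast hab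
    simp only [real_smul]
    linear_combination -this

theorem isSharpRadiusFor_of_koebe_mem {𝓖 : Set (ℂ → ℂ)} (h𝓖 : 𝓖 ⊆ classS) (hk : koebe ∈ 𝓖) :
    IsSharpRadiusFor 𝓖 (1 / 5) := by
  refine isSharpRadiusFor_of (by norm_num) (by norm_num) (fun G hG => (h𝓖 hG).1)
    (fun G hG hne z hz => lt_re_of_mem_classS (h𝓖 hG) hne hz) hk
    (fun z hz => (hasDerivAt_koebe (one_sub_ne_zero_of_mem hz)).deriv)
    (fun z hz => div_ne_zero (one_add_ne_zero_of_mem hz)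
      (pow_ne_zero 3 (one_sub_ne_zero_of_mem hz))) ?_
  intro x hx hx1
  have h1 : 1 - x ≠ 0 := by linarith
  have h2 : 1 + x ≠ 0 := by linarith
  -- The logarithmic derivative 1/(1 + z) + 3/(1 - z) of (1 + z)/(1 - z)³ at z = -x.
  refine ⟨(4 - 2 * x) / ((1 + x) * (1 - x)), ?_, ?_⟩
  · have h1' : (1 - x : ℂ) ≠ 0 := by exact_mod_cast h1
    have h2' : (1 + x : ℂ) ≠ 0 := by exact_mod_cast h2
    have hz : (1 - ((-x : ℝ) : ℂ)) ≠ 0 := by push_cast; simpa using h2'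
    have h := ((hasDerivAt_id ((-x : ℝ) : ℂ)).const_add 1).div
      (((hasDerivAt_id ((-x : ℝ) : ℂ)).const_sub 1).pow 3) (pow_ne_zero 3 hz)
    convert! h using 1
    simp only [id, Pi.pow_apply]
    push_cast
    rw [sub_neg_eq_add, ← sub_eq_add_neg]
    field_simp
    ring
  · have e : 1 - x * ((4 - 2 * x) / ((1 + x) * (1 - x)) + 1 / (1 - x)) =
        (1 - 5 * x) / ((1 + x) * (1 - x)) := by
      field_simp
      ring
    rw [e]
    exact div_neg_of_neg_of_pos (by linarith) (mul_pos (by linarith) (by linarith))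

theorem hasDerivAt_div_one_sub {z : ℂ} (hz : 1 - z ≠ 0) :
    HasDerivAt (fun z : ℂ => z / (1 - z)) (1 / (1 - z) ^ 2) z := by
  have h := (hasDerivAt_id z).div ((hasDerivAt_id z).const_sub 1) hz
  convert! h using 1
  simp

theorem image_div_one_sub : (fun z : ℂ => z / (1 - z)) '' unitDisk = {w | -(1 / 2) < w.re} := by
  have key : ∀ z : ℂ, 1 - z ≠ 0 → (1 + z) / (1 - z) = 1 + 2 * (z / (1 - z)) := by
    intro z hz
    field_simp
    ring
  ext w
  constructor
  · rintro ⟨z, hz, rfl⟩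
    have h := re_one_add_div_one_sub_pos hz
    rw [key z (one_sub_ne_zero_of_mem hz)] at h
    change -(1 / 2) < (z / (1 - z)).re
    generalize z / (1 - z) = v at h ⊢
    simp at h
    linarith
  · intro hw
    have hw' : -(1 / 2) < w.re := hw
    obtain ⟨z, hz, h⟩ := exists_eq_one_add_div_one_sub (v := 1 + 2 * w) (by simp; linarith)
    refine ⟨z, hz, ?_⟩
    rw [key z (one_sub_ne_zero_of_mem hz)] at h
    linear_combination h / 2

theorem div_one_sub_mem_classK : (fun z : ℂ => z / (1 - z)) ∈ classK := by
  have h0 : (0 : ℂ) ∈ unitDisk := by simp [unitDisk]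
  refine ⟨⟨⟨fun z hz => (hasDerivAt_div_one_sub (one_sub_ne_zero_of_mem
    hz)).differentiableAt.differentiableWithinAt, by simp, ?_⟩, ?_⟩, ?_⟩
  · rw [(hasDerivAt_div_one_sub (one_sub_ne_zero_of_mem h0)).deriv]
    simp
  · intro z hz w hw h
    simp only at h
    rw [div_eq_div_iff (one_sub_ne_zero_of_mem hz) (one_sub_ne_zero_of_mem hw)] at h
    linear_combination h
  · rw [image_div_one_sub]
    exact convex_halfSpace_re_gt _

theorem isSharpRadiusFor_classK : IsSharpRadiusFor classK (1 / 3) := by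
  refine isSharpRadiusFor_of (by norm_num) (by norm_num) (fun G hG => hG.1.1)
    (fun G hG hne z hz => lt_re_of_mem_classK hG hne hz) div_one_sub_mem_classK
    (fun z hz => (hasDerivAt_div_one_sub (one_sub_ne_zero_of_mem hz)).deriv)
    (fun z hz => div_ne_zero one_ne_zero (pow_ne_zero 2 (one_sub_ne_zero_of_mem hz))) ?_
  intro x hx hx1
  have h1 : 1 - x ≠ 0 := by linarith
  have h2 : 1 + x ≠ 0 := by linarith
  refine ⟨2 / (1 + x), ?_, ?_⟩
  · have h2' : (1 + x : ℂ) ≠ 0 := by exact_mod_cast h2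
    have hz : (1 - ((-x : ℝ) : ℂ)) ≠ 0 := by push_cast; simpa using h2'
    have h := (hasDerivAt_const ((-x : ℝ) : ℂ) (1 : ℂ)).div
      (((hasDerivAt_id ((-x : ℝ) : ℂ)).const_sub 1).pow 2) (pow_ne_zero 2 hz)
    convert! h using 1
    simp only [id, Pi.pow_apply]
    push_cast
    rw [sub_neg_eq_add]
    field_simp
    ring
  · have e : 1 - x * (2 / (1 + x) + 1 / (1 - x)) = (1 - 3 * x) / ((1 + x) * (1 - x)) := by
      field_simp
      ring
    rw [e]
    exact div_neg_of_neg_of_pos (by linarith) (mul_pos (by linarith) (by linarith))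

theorem isSharpRadiusFor_classR : IsSharpRadiusFor classR ((Real.sqrt 17 - 3) / 4) := by
  have h17 : Real.sqrt 17 ^ 2 = 17 := Real.sq_sqrt (by norm_num)
  have h17n : 0 ≤ Real.sqrt 17 := Real.sqrt_nonneg 17
  have hd : ∀ z : ℂ, 1 - z ≠ 0 → HasDerivAt (fun z : ℂ => (1 + z) / (1 - z)) (2 / (1 - z) ^ 2) z := by
    intro z hz
    have h := ((hasDerivAt_id z).const_add 1).div ((hasDerivAt_id z).const_sub 1) hz
    convert! h using 1
    simp only [id]
    ring
  obtain ⟨G, hG, hGP⟩ := exists_mem_classA_deriv_eq (P := fun z => (1 + z) / (1 - z))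
    (fun z hz => (hd z (one_sub_ne_zero_of_mem hz)).differentiableAt.differentiableWithinAt)
    (by simp)
  refine isSharpRadiusFor_of (by nlinarith) (by nlinarith) (fun G hG => hG.1)
    (fun G hG _ z hz => lt_re_of_mem_classR hG hz) (G := G)
    ⟨hG, fun z hz => by rw [hGP z hz]; exact re_one_add_div_one_sub_pos hz⟩ hGP
    (fun z hz => div_ne_zero (one_add_ne_zero_of_mem hz) (one_sub_ne_zero_of_mem hz)) ?_
  intro x hx hx1
  have hx0 : 0 < x := by nlinarith
  have h1 : 1 - x ≠ 0 := by linarith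
  have h2 : 1 + x ≠ 0 := by linarith
  -- The logarithmic derivative 2/(1 - z²) of (1 + z)/(1 - z) at z = -x.
  refine ⟨2 / ((1 + x) * (1 - x)), ?_, ?_⟩
  · have h1' : (1 - x : ℂ) ≠ 0 := by exact_mod_cast h1
    have h2' : (1 + x : ℂ) ≠ 0 := by exact_mod_cast h2
    have hz : (1 - ((-x : ℝ) : ℂ)) ≠ 0 := by push_cast; simpa using h2'
    convert! hd _ hz using 1
    push_cast
    rw [sub_neg_eq_add, ← sub_eq_add_neg]
    field_simp
  · have e : 1 - x * (2 / ((1 + x) * (1 - x)) + 1 / (1 - x)) =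
        (1 - 3 * x - 2 * x ^ 2) / ((1 + x) * (1 - x)) := by
      field_simp
      ring
    rw [e]
    exact div_neg_of_neg_of_pos (by nlinarith) (mul_pos (by linarith) (by linarith))

/-! ### The quartic and the extremal function for ℛ_{1/2} -/

theorem half_lt_re_div_sub {N V : ℂ} (h : ‖V‖ < ‖N‖) : 1 / 2 < (N / (N - V)).re := by
  have hne : N - V ≠ 0 := by
    intro h0
    rw [sub_eq_zero.1 h0] at h
    exact lt_irrefl _ h
  have h2 := pow_lt_pow_left₀ h (norm_nonneg _) two_ne_zero
  rw [← normSq_eq_norm_sq, ← normSq_eq_norm_sq, normSq_apply, normSq_apply] at h2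
  rw [div_re, ← add_div, lt_div_iff₀ (normSq_pos.2 hne), normSq_apply]
  simp only [sub_re, sub_im]
  nlinarith

/-- It says that w = z(c - z)/(1 - cz) is a self-map of the disk, so that G' = 1/(1 - w) has real
part above 1/2. The reason is |1 - cz|² - |c - z|² = (1 - c²)(1 - |z|²). -/
theorem norm_mul_sub_lt_of_mem {c : ℝ} (hc0 : 0 ≤ c) (hc1 : c < 1) {z : ℂ} (hz : z ∈ unitDisk) :
    ‖z * (c - z)‖ < ‖1 - c * z‖ := by
  have hz' : ‖z‖ < 1 := by simpa [unitDisk] using hz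
  have h1 : ‖(c : ℂ) - z‖ < ‖1 - c * z‖ := by
    apply lt_of_pow_lt_pow_left₀ 2 (norm_nonneg _)
    have h2 := normSq_lt_one_of_mem hz
    rw [← normSq_eq_norm_sq, ← normSq_eq_norm_sq]
    simp only [normSq_apply, mul_re, mul_im, sub_re, sub_im, one_re, one_im, ofReal_re, ofReal_im]
    nlinarith [mul_pos (sub_pos.2 h2) (by nlinarith : (0 : ℝ) < 1 - c ^ 2)]
  rw [norm_mul]
  exact (mul_le_of_le_one_left (norm_nonneg _) hz'.le).trans_lt h1

/-- The quartic changes sign on (0, 1/2), and it increases on the positive axis because its only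
negative coefficient is the constant one. -/
theorem exists_isLeast_root : ∃ r : ℝ, 0 < r ∧ r < 1 / 2 ∧
    r ^ 4 + 2 * r ^ 3 + 13 * r ^ 2 + 4 * r - 4 = 0 ∧
    IsLeast {x : ℝ | 0 < x ∧ x ^ 4 + 2 * x ^ 3 + 13 * x ^ 2 + 4 * x - 4 = 0} r := by
  obtain ⟨r, ⟨hr0, hr1⟩, hr⟩ : ∃ r ∈ Ioo (0 : ℝ) (1 / 2),
      r ^ 4 + 2 * r ^ 3 + 13 * r ^ 2 + 4 * r - 4 = 0 :=
    intermediate_value_Ioo (f := fun r : ℝ => r ^ 4 + 2 * r ^ 3 + 13 * r ^ 2 + 4 * r - 4)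
      (by norm_num) (by fun_prop) ⟨by norm_num, by norm_num⟩
  refine ⟨r, hr0, hr1, hr, ⟨hr0, hr⟩, ?_⟩
  rintro x ⟨hx0, hx⟩
  by_contra h
  push Not at h
  have h2 := pow_lt_pow_left₀ h hx0.le (n := 2) (by norm_num)
  have h3 := pow_lt_pow_left₀ h hx0.le (n := 3) (by norm_num)
  have h4 := pow_lt_pow_left₀ h hx0.le (n := 4) (by norm_num)
  linarith

/-- The expression is Q(x), and Q(r) = 0 by the choice of c. From r to x the term -1/(1 + cy) gains
at most x - r, the term -y/(1 - y) loses more than x - r, and the last fraction does not increase;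
so Q(x) < Q(r). -/
theorem one_sub_mul_neg_of_root_lt {r x : ℝ} (hr0 : 0 < r) (hrx : r < x) (hx1 : x < 1)
    (hr : r ^ 4 + 2 * r ^ 3 + 13 * r ^ 2 + 4 * r - 4 = 0) {c : ℝ} (hc : c = 1 / (2 + r)) :
    1 - x * (-c / (1 + c * x) + (2 * c + 2 * x) / (1 + 2 * c * x + x ^ 2) + 1 / (1 - x)) < 0 := by
  have hc0 : 0 < c := by rw [hc]; positivity
  have hc1 : c < 1 := by rw [hc, div_lt_one (by linarith)]; linarith
  have hx0 : 0 < x := hr0.trans hrx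
  set Q : ℝ → ℝ := fun y =>
    1 - 1 / (1 + c * y) - y / (1 - y) + (1 - y ^ 2) / (1 + 2 * c * y + y ^ 2) with hQ
  have e : 1 - x * (-c / (1 + c * x) + (2 * c + 2 * x) / (1 + 2 * c * x + x ^ 2) + 1 / (1 - x)) =
      Q x := by
    have h1 : 1 - x ≠ 0 := by linarith
    have h2 : 1 + c * x ≠ 0 := by positivity
    have h3 : 1 + 2 * c * x + x ^ 2 ≠ 0 := by positivity
    simp only [hQ]
    field_simp
    ring
  have hQr : Q r = 0 := by
    have h1 : 1 - r ≠ 0 := by linarith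
    have h2 : 1 + c * r = (2 + 2 * r) / (2 + r) := by rw [hc]; field_simp; ring
    have h3 : 1 + 2 * c * r + r ^ 2 = (1 + r) * (2 + r + r ^ 2) / (2 + r) := by
      rw [hc]; field_simp; ring
    have h5 : Q r = -(r ^ 4 + 2 * r ^ 3 + 13 * r ^ 2 + 4 * r - 4) /
        (2 * (1 + r) * (1 - r) * (2 + r + r ^ 2)) := by
      simp only [hQ]
      rw [h2, h3]
      have h6 : 2 + r + r ^ 2 ≠ 0 := by positivity
      have h7 : 1 + r ≠ 0 := by positivity
      have h8 : 2 + 2 * r ≠ 0 := by positivity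
      field_simp
      ring
    rw [h5, hr]
    simp
  rw [e, ← hQr]
  have d1 : 1 / (1 + c * r) - 1 / (1 + c * x) ≤ x - r := by
    have h2 : 0 < 1 + c * x := by positivity
    have h3 : 0 < 1 + c * r := by positivity
    rw [div_sub_div _ _ h3.ne' h2.ne', div_le_iff₀ (mul_pos h3 h2)]
    have h4 : 1 ≤ (1 + c * r) * (1 + c * x) := by nlinarith [mul_pos hc0 hr0, mul_pos hc0 hx0]
    nlinarith [mul_le_mul_of_nonneg_left h4 (by linarith : 0 ≤ x - r)]
  have d2 : x - r < x / (1 - x) - r / (1 - r) := by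
    have h2 : 0 < 1 - x := by linarith
    have h3 : 0 < 1 - r := by linarith
    rw [div_sub_div _ _ h2.ne' h3.ne', lt_div_iff₀ (mul_pos h2 h3)]
    have h4 : (1 - x) * (1 - r) < 1 := by nlinarith
    nlinarith [mul_lt_mul_of_pos_left h4 (by linarith : 0 < x - r)]
  have d3 : (1 - x ^ 2) / (1 + 2 * c * x + x ^ 2) ≤ (1 - r ^ 2) / (1 + 2 * c * r + r ^ 2) := by
    have h2 : r ^ 2 ≤ x ^ 2 := pow_le_pow_left₀ hr0.le hrx.le 2
    have h3 := mul_le_mul_of_nonneg_left hrx.le hc0.le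
    exact div_le_div₀ (by nlinarith) (by linarith) (by positivity) (by linarith)
  simp only [hQ]
  linarith

theorem isSharpRadiusFor_classRHalf {r : ℝ} (hr0 : 0 < r) (hr1 : r < 1 / 2)
    (hr : r ^ 4 + 2 * r ^ 3 + 13 * r ^ 2 + 4 * r - 4 = 0) : IsSharpRadiusFor classRHalf r := by
  -- This c makes 1 - w(-r) = (2 + r + r²)/2, the double root at s = r of the quadratic in t = |1 -
  -- w| behind the lower bound. Every estimate there is then an equality at z = -r.
  set c : ℝ := 1 / (2 + r) with hc
  have hc0 : 0 < c := by rw [hc]; positivity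
  have hc1 : c < 1 := by rw [hc, div_lt_one (by linarith)]; linarith
  set P : ℂ → ℂ := fun z => (1 - c * z) / (1 - c * z - z * (c - z)) with hP
  have hN : ∀ z ∈ unitDisk, 1 - c * z ≠ 0 := fun z hz =>
    norm_pos_iff.1 ((norm_nonneg _).trans_lt (norm_mul_sub_lt_of_mem hc0.le hc1 hz))
  have hD : ∀ z ∈ unitDisk, 1 - c * z - z * (c - z) ≠ 0 := by
    intro z hz h0
    have := norm_mul_sub_lt_of_mem hc0.le hc1 hz
    rw [sub_eq_zero.1 h0] at this
    exact lt_irrefl _ this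
  have hPd : ∀ z ∈ unitDisk, HasDerivAt P
      (P z * (-c / (1 - c * z) - (2 * z - 2 * c) / (1 - c * z - z * (c - z)))) z := by
    intro z hz
    have h1 : HasDerivAt (fun z : ℂ => 1 - c * z) (-(c * 1)) z :=
      ((hasDerivAt_id z).const_mul (c : ℂ)).const_sub 1
    have h2 : HasDerivAt (fun z : ℂ => z * (c - z)) (1 * (c - z) + z * (-1)) z :=
      (hasDerivAt_id z).mul ((hasDerivAt_id z).const_sub (c : ℂ))
    have h := h1.div (h1.sub h2) (hD z hz)
    convert! h using 1
    have h3 := hN z hz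
    have h4 := hD z hz
    simp only [hP, Pi.sub_apply]
    field_simp
    ring
  obtain ⟨G, hG, hGP⟩ := exists_mem_classA_deriv_eq
    (fun z hz => (hPd z hz).differentiableAt.differentiableWithinAt) (by simp [hP])
  refine isSharpRadiusFor_of hr0 (by linarith) (fun G hG => hG.1) (fun G hG _ z hz => ?_) (G := G)
    ⟨hG, fun z hz => ?_⟩ hGP (fun z hz => div_ne_zero (hN z hz) (hD z hz)) ?_
  · refine lt_re_of_mem_classRHalf hG (by linarith) ?_
    have h0 := norm_nonneg z
    have h2 := pow_le_pow_left₀ h0 hz.le 2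
    have h3 := pow_le_pow_left₀ h0 hz.le 3
    have h4 := pow_le_pow_left₀ h0 hz.le 4
    nlinarith
  · rw [hGP z hz]
    exact half_lt_re_div_sub (norm_mul_sub_lt_of_mem hc0.le hc1 hz)
  · intro x hx hx1
    have hx0 : 0 < x := hr0.trans hx
    -- The logarithmic derivative of P = (1 - cz)/(1 - 2cz + z²) at z = -x.
    refine ⟨-c / (1 + c * x) + (2 * c + 2 * x) / (1 + 2 * c * x + x ^ 2), ?_,
      one_sub_mul_neg_of_root_lt hr0 hx hx1 hr hc⟩
    have hxU : ((-x : ℝ) : ℂ) ∈ unitDisk := by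
      rw [unitDisk, mem_ball_zero_iff, norm_real, norm_neg, Real.norm_of_nonneg hx0.le]
      exact hx1
    convert! hPd _ hxU using 2
    have e1 : (1 - c * ((-x : ℝ) : ℂ)) = 1 + c * x := by push_cast; ring
    have e2 : (1 - c * ((-x : ℝ) : ℂ) - ((-x : ℝ) : ℂ) * (c - ((-x : ℝ) : ℂ))) =
        1 + 2 * c * x + x ^ 2 := by push_cast; ring
    rw [e2, e1]
    push_cast
    ring

end HarmonicConvexity

theorem theorem4p8 :
    HarmonicConvexity.IsSharpRadiusFor HarmonicConvexity.classS (1 / 5) ∧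
    HarmonicConvexity.IsSharpRadiusFor HarmonicConvexity.classSStar (1 / 5) ∧
    HarmonicConvexity.IsSharpRadiusFor HarmonicConvexity.classK (1 / 3) ∧
    HarmonicConvexity.IsSharpRadiusFor HarmonicConvexity.classR ((Real.sqrt 17 - 3) / 4) ∧
    (∃ r : ℝ, IsLeast {x : ℝ | 0 < x ∧ x ^ 4 + 2 * x ^ 3 + 13 * x ^ 2 + 4 * x - 4 = 0} r ∧
      HarmonicConvexity.IsSharpRadiusFor HarmonicConvexity.classRHalf r) := by
  obtain ⟨r, hr0, hr1, hr, hleast⟩ := HarmonicConvexity.exists_isLeast_root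
  exact ⟨HarmonicConvexity.isSharpRadiusFor_of_koebe_mem subset_rfl
      (HarmonicConvexity.classSStar_subset_classS HarmonicConvexity.koebe_mem_classSStar),
    HarmonicConvexity.isSharpRadiusFor_of_koebe_mem HarmonicConvexity.classSStar_subset_classS
      HarmonicConvexity.koebe_mem_classSStar,
    HarmonicConvexity.isSharpRadiusFor_classK, HarmonicConvexity.isSharpRadiusFor_classR,
    r, hleast, HarmonicConvexity.isSharpRadiusFor_classRHalf hr0 hr1 hr⟩
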